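/- Let $\mathbb D$ be the open unit disk of $\mathbb C$ and let $\alpha\ge -1$. Let $\mathfrak B_\alpha$ be the Hilbert space of analytic functions $f(z)=\sum_{n\ge 0}a_nz^n$ on $\mathbb D$ with $$\|f\|_\alpha^2=\sum_{n=0}^\infty \frac{n!\,\Gamma(2+\alpha)}{\Gamma(n+2+\alpha)}\,|a_n|^2<\infty$$ (for $\alpha>-1$ this is the weighted Bergman space, with $\|f\|_\alpha^2=\frac{\alpha+1}{\pi}\int_{\mathbb D}|f(z)|^2(1-|z|^2)^\alpha\,dx\,dy$; for $\alpha=-1$ it is the Hardy space $H^2$). For a bounded operator $T$ and $n\ge 1$, let $a_n(T)=\inf\{\|T-R\| : R \text{ bounded},\ \operatorname{rank} R<n\}$ be its $n$-th approximation number, and let $\beta(T)=\liminf_{n\to\infty}a_n(T)^{1/n}$. Let $\varphi$ be a Schur function, that is, a non-constant analytic map $\varphi:\mathbb D\to\mathbb D$, and put $$[\varphi]=\sup_{z\in\mathbb D}\frac{|\varphi'(z)|\,(1-|z|^2)}{1-|\varphi(z)|^2}.$$ Then $C_\varphi f=f\circ\varphi$ defines a bounded operator $C_\varphi:\mathfrak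 B_\alpha\to\mathfrak B_\alpha$, and: 1. there are constants $c>0$ and $0<r<1$ such that $a_n(C_\varphi)\ge c\,r^n$ for all $n\ge 1$; 2. $\beta(C_\varphi)\ge[\varphi]^2$; 3. for every $\kappa$ with $0\le\kappa<[\varphi]$ there is a constant $c_\kappa>0$ such that $a_n(C_\varphi)\ge c_\kappa\,\kappa^{2n}$ for all $n\ge 1$. -/

import Mathlib

open Metric Filter

noncomputable section

/-- The `n`-th Taylor coefficient at the origin of a function `f`. -/
def taylorCoeff (f : ℂ → ℂ) (n : ℕ) : ℂ := (n.factorial : ℂ)⁻¹ * iteratedDeriv n f 0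

/-- The weight `n! Γ(2 + α) / Γ(n + 2 + α)`. For `α = -1` it is equal to `1` for every `n`. -/
def bergmanWeight (α : ℝ) (n : ℕ) : ℝ :=
  (n.factorial : ℝ) * Real.Gamma (2 + α) / Real.Gamma (n + 2 + α)

theorem bergmanWeight_pos {α : ℝ} (hα : -1 ≤ α) (n : ℕ) : 0 < bergmanWeight α n := by
  have h1 : 0 < Real.Gamma (2 + α) := Real.Gamma_pos_of_pos (by linarith)
  have h2 : 0 < Real.Gamma (n + 2 + α) :=
    Real.Gamma_pos_of_pos (by have : (0 : ℝ) ≤ n := Nat.cast_nonneg n; linarith)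
  unfold bergmanWeight
  positivity

theorem bergmanWeight_neg_one (n : ℕ) : bergmanWeight (-1) n = 1 := by
  have h : (n : ℝ) + 2 + -1 = n + 1 := by ring
  have h' : (2 : ℝ) + -1 = 1 := by norm_num
  unfold bergmanWeight
  rw [h, h', Real.Gamma_nat_eq_factorial, Real.Gamma_one, mul_one]
  exact div_self (by positivity)

theorem contDiffAt_of_disc {f : ℂ → ℂ} (hf : DifferentiableOn ℂ f (ball 0 1)) (n : ℕ) :
    ContDiffAt ℂ n f 0 :=
  (hf.analyticAt (ball_mem_nhds 0 one_pos)).contDiffAt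

theorem taylorCoeff_add {f g : ℂ → ℂ} (hf : DifferentiableOn ℂ f (ball 0 1))
    (hg : DifferentiableOn ℂ g (ball 0 1)) (n : ℕ) :
    taylorCoeff (f + g) n = taylorCoeff f n + taylorCoeff g n := by
  unfold taylorCoeff
  rw [iteratedDeriv_add (contDiffAt_of_disc hf n) (contDiffAt_of_disc hg n), mul_add]

theorem taylorCoeff_smul (c : ℂ) (f : ℂ → ℂ) (n : ℕ) :
    taylorCoeff (c • f) n = c * taylorCoeff f n := by
  unfold taylorCoeff
  rw [iteratedDeriv_const_smul_field, smul_eq_mul]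
  ring

theorem taylorCoeff_zero (n : ℕ) : taylorCoeff 0 n = 0 := by
  simpa using taylorCoeff_smul 0 0 n

/-- The analytic functions `f(z) = ∑ aₙ zⁿ` on the open unit disc for which
`∑ n! Γ(2 + α) / Γ(n + 2 + α) |aₙ|²` is finite. A function on the disc is represented by its
extension by zero to the complex plane, so that distinct elements are distinct functions on the
disc. -/
def bergmanSubmodule (α : ℝ) (hα : -1 ≤ α) : Submodule ℂ (ℂ → ℂ) where
  carrier := {f | DifferentiableOn ℂ f (ball 0 1) ∧ (∀ z, z ∉ ball (0 : ℂ) 1 → f z = 0) ∧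
    Summable fun n => bergmanWeight α n * ‖taylorCoeff f n‖ ^ 2}
  zero_mem' := by
    refine ⟨differentiableOn_const 0, fun _ _ => rfl, ?_⟩
    simp [taylorCoeff_zero, summable_zero]
  add_mem' := by
    rintro f g ⟨hf, hf0, hfs⟩ ⟨hg, hg0, hgs⟩
    refine ⟨hf.add hg, fun z hz => by simp [hf0 z hz, hg0 z hz], ?_⟩
    refine Summable.of_nonneg_of_le
      (fun n => mul_nonneg (bergmanWeight_pos hα n).le (sq_nonneg _)) (fun n => ?_)
      ((hfs.add hgs).mul_left 2)
    rw [taylorCoeff_add hf hg]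
    have h1 := norm_add_le (taylorCoeff f n) (taylorCoeff g n)
    have h2 : ‖taylorCoeff f n + taylorCoeff g n‖ ^ 2
        ≤ 2 * (‖taylorCoeff f n‖ ^ 2 + ‖taylorCoeff g n‖ ^ 2) := by
      nlinarith [sq_nonneg (‖taylorCoeff f n‖ - ‖taylorCoeff g n‖),
        norm_nonneg (taylorCoeff f n + taylorCoeff g n)]
    nlinarith [mul_le_mul_of_nonneg_left h2 (bergmanWeight_pos hα n).le]
  smul_mem' := by
    rintro c f ⟨hf, hf0, hfs⟩
    refine ⟨hf.const_smul c, fun z hz => by simp [hf0 z hz], ?_⟩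
    refine (hfs.mul_left (‖c‖ ^ 2)).congr fun n => ?_
    rw [taylorCoeff_smul, norm_mul]
    ring

/-- The weighted Bergman space of parameter `α ≥ -1`; for `α = -1` it is the Hardy space `H²`.
It is a type of its own, since its topology is that of the norm below. -/
def BergmanSpace (α : ℝ) (hα : -1 ≤ α) : Type := bergmanSubmodule α hα

namespace BergmanSpace

variable {α : ℝ} {hα : -1 ≤ α}

instance : AddCommGroup (BergmanSpace α hα) :=
  inferInstanceAs (AddCommGroup (bergmanSubmodule α hα))

instance : Module ℂ (BergmanSpace α hα) :=
  inferInstanceAs (Module ℂ (bergmanSubmodule α hα))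

instance : CoeFun (BergmanSpace α hα) (fun _ => ℂ → ℂ) := ⟨fun f => f.1⟩

theorem ext {f g : BergmanSpace α hα} (h : ∀ z ∈ ball (0 : ℂ) 1, f z = g z) : f = g := by
  refine Subtype.ext (funext fun z => ?_)
  by_cases hz : z ∈ ball (0 : ℂ) 1
  · exact h z hz
  · exact (f.2.2.1 z hz).trans (g.2.2.1 z hz).symm

theorem memlp (f : BergmanSpace α hα) :
    Memℓp (fun n => ((√(bergmanWeight α n) : ℝ) : ℂ) * taylorCoeff f n) 2 := by
  rw [memℓp_gen_iff (by norm_num)]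
  refine f.2.2.2.congr fun n => ?_
  have h := Real.sq_sqrt (bergmanWeight_pos hα n).le
  simp only [ENNReal.toReal_ofNat, Real.rpow_ofNat, norm_mul, Complex.norm_real, mul_pow,
    Real.norm_eq_abs, sq_abs, h]

/-- The linear map sending `∑ aₙ zⁿ` to the square summable sequence of the `√(wₙ) aₙ`, where
`wₙ` is the weight. -/
def toL2 : BergmanSpace α hα →ₗ[ℂ] lp (fun _ : ℕ => ℂ) 2 where
  toFun f := ⟨_, memlp f⟩
  map_add' f g := by
    ext n
    change (_ : ℂ) * taylorCoeff (f.1 + g.1) n = _ * taylorCoeff f.1 n + _ * taylorCoeff g.1 n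
    rw [taylorCoeff_add f.2.1 g.2.1, mul_add]
  map_smul' c f := by
    ext n
    change (_ : ℂ) * taylorCoeff (c • f.1) n = c * (_ * taylorCoeff f.1 n)
    rw [taylorCoeff_smul]
    ring

theorem toL2_injective : Function.Injective (toL2 : BergmanSpace α hα →ₗ[ℂ] _) := by
  intro f g hfg
  refine ext fun z hz => ?_
  have hc : ∀ n, taylorCoeff f n = taylorCoeff g n := by
    intro n
    have h : ((√(bergmanWeight α n) : ℝ) : ℂ) * taylorCoeff f n
        = ((√(bergmanWeight α n) : ℝ) : ℂ) * taylorCoeff g n :=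
      congrFun (congrArg Subtype.val hfg) n
    refine mul_left_cancel₀ ?_ h
    exact_mod_cast (Real.sqrt_pos.2 (bergmanWeight_pos hα n)).ne'
  rw [← Complex.taylorSeries_eq_on_ball' hz f.2.1, ← Complex.taylorSeries_eq_on_ball' hz g.2.1]
  exact tsum_congr fun n => congrArg (· * (z - 0) ^ n) (hc n)

instance : NormedAddCommGroup (BergmanSpace α hα) :=
  NormedAddCommGroup.induced _ _ toL2 toL2_injective

instance : InnerProductSpace ℂ (BergmanSpace α hα) := InnerProductSpace.induced toL2

/-- The norm of the space is the one of the definition: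
`‖f‖² = ∑ n! Γ(2 + α) / Γ(n + 2 + α) |aₙ|²`. -/
theorem norm_sq_eq (f : BergmanSpace α hα) :
    ‖f‖ ^ 2 = ∑' n, bergmanWeight α n * ‖taylorCoeff f n‖ ^ 2 := by
  have h := lp.norm_rpow_eq_tsum (p := 2) (by norm_num) (toL2 f)
  simp only [ENNReal.toReal_ofNat, Real.rpow_ofNat] at h
  refine (h : ‖f‖ ^ 2 = _).trans (tsum_congr fun n => ?_)
  change ‖((√(bergmanWeight α n) : ℝ) : ℂ) * taylorCoeff f n‖ ^ 2 = _
  rw [norm_mul, mul_pow, Complex.norm_real, Real.norm_eq_abs, sq_abs,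
    Real.sq_sqrt (bergmanWeight_pos hα n).le]

end BergmanSpace

/-- A Schur function: a non-constant analytic self-map of the open unit disc. Only the values on
the disc matter. -/
structure IsSchur (φ : ℂ → ℂ) : Prop where
  differentiableOn : DifferentiableOn ℂ φ (ball 0 1)
  mapsTo : Set.MapsTo φ (ball 0 1) (ball 0 1)
  nonconstant : ¬ ∃ c, ∀ z ∈ ball (0 : ℂ) 1, φ z = c

/-- The bounded operator `C` is the composition operator `f ↦ f ∘ φ`. -/
def IsCompositionOperator {α : ℝ} {hα : -1 ≤ α} (φ : ℂ → ℂ)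
    (C : BergmanSpace α hα →L[ℂ] BergmanSpace α hα) : Prop :=
  ∀ f : BergmanSpace α hα, ∀ z ∈ ball (0 : ℂ) 1, C f z = f (φ z)

/-- The approximation number `aₙ(T) = inf {‖T - R‖ : rank R < n}`, for `n ≥ 1`. -/
def approxNumber {E F : Type*} [NormedAddCommGroup E] [NormedSpace ℂ E] [NormedAddCommGroup F]
    [NormedSpace ℂ F] (T : E →L[ℂ] F) (n : ℕ) : ℝ :=
  sInf {x | ∃ R : E →L[ℂ] F, (R : E →ₗ[ℂ] F).rank < n ∧ x = ‖T - R‖}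

/-- `β(T) = liminf aₙ(T)^{1/n}`; the sequence is bounded because `0 ≤ aₙ(T) ≤ ‖T‖`. -/
def betaLower {E F : Type*} [NormedAddCommGroup E] [NormedSpace ℂ E] [NormedAddCommGroup F]
    [NormedSpace ℂ F] (T : E →L[ℂ] F) : ℝ :=
  liminf (fun n : ℕ => approxNumber T n ^ (1 / (n : ℝ))) atTop

/-- The pseudo-hyperbolic derivative `|φ'(z)| (1 - |z|²) / (1 - |φ(z)|²)`. -/
def pseudoHypDeriv (φ : ℂ → ℂ) (z : ℂ) : ℝ :=
  ‖deriv φ z‖ * (1 - ‖z‖ ^ 2) / (1 - ‖φ z‖ ^ 2)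

/-- `[φ]`, the supremum over the open unit disc of the pseudo-hyperbolic derivative; for an analytic
self-map of the disc the values are at most `1`. -/
def pseudoHypSup (φ : ℂ → ℂ) : ℝ := sSup (pseudoHypDeriv φ '' ball 0 1)

end

/-!
# Approximation numbers of composition operators on weighted Bergman spaces

**Boundedness.** Littlewood's subordination principle is used in an algebraic form. For a polynomial
`p`, the function `‖p‖²` has on the disc a harmonic majorant `Re F`, with `F` entire, controlled at
each point of the open disc by the sum of the squared coefficients of `p`
(`exists_harmonic_majorant`); `F` is built by induction on the degree from `p = a₀ + w q`. Averaging
`Re F ∘ φ` over a circle gives its value at the origin, and Bessel's inequality bounds the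
coefficients of `p ∘ φ` (`sum_taylorCoeff_comp_le`). By the Schwarz–Pick lemma the disc of squared
radius `1 - 1 / (N + 2)` is mapped into one of squared radius `1 - c / (N + 2)`, so that the partial
sums of the squared coefficients of `p ∘ φ` up to `N` are controlled by the squared coefficients of
`p` weighted by `(1 - c / (N + 2)) ^ k`. A summation by parts against the decreasing weights of the
space, which decay at most polynomially, turns this into a bound for the weighted sums
(`exists_weightedSum_comp_polynomial_le`) uniformly for `α ≥ -1`, with no distinction between the
Hardy and the Bergman case. Locally uniform approximation by Taylor polynomials extends it to the
whole space (`exists_compositionOperator`).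

**Lower bound.** Let `λ` be the pseudo-hyperbolic derivative of `φ` at a point `a`. Composing `φ` with
automorphisms of the disc, which induce bounded operators, produces a symbol `ψ` fixing the origin
with `|ψ'(0)| = λ`. In the orthonormal basis of normalised monomials its operator `T` is triangular
with diagonal `ψ'(0)ᵏ`. Compress `T` to the first `2m` basis vectors: the determinant has modulus
`λ ^ (m (2m - 1))`. If `R` has rank less than `m`, the compression of `T` coincides with that of
`T - R` on `m` vectors of some orthonormal basis, so Hadamard's inequality bounds the determinant by
`‖T - R‖ ^ m ‖T‖ ^ m` (`norm_det_le_of_finrank_range_lt`). Hence `λ ^ (2m) ≤ ‖T - R‖ ‖T‖`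
(`norm_pow_le_norm_sub_mul_norm`). Taking `λ` close to its supremum gives the geometric lower bounds,
and the bound for the lower limit of the roots follows.
-/

/-! ### Taylor coefficients -/

theorem taylorCoeff_congr {f g : ℂ → ℂ} (h : Set.EqOn f g (ball 0 1)) (n : ℕ) :
    taylorCoeff f n = taylorCoeff g n := by
  unfold taylorCoeff
  rw [h.iteratedDeriv_of_isOpen isOpen_ball n (mem_ball_self one_pos)]

theorem taylorCoeff_zero_right (f : ℂ → ℂ) : taylorCoeff f 0 = f 0 := by
  simp [taylorCoeff]

theorem taylorCoeff_id_mul_zero (g : ℂ → ℂ) : taylorCoeff (fun z => z * g z) 0 = 0 := by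
  simp [taylorCoeff]

theorem taylorCoeff_id_mul_succ {g : ℂ → ℂ} (hg : DifferentiableOn ℂ g (ball 0 1)) (n : ℕ) :
    taylorCoeff (fun z => z * g z) (n + 1) = taylorCoeff g n := by
  unfold taylorCoeff
  rw [iteratedDeriv_fun_mul (f := fun z => z) contDiffAt_id (contDiffAt_of_disc hg (n + 1)),
    Finset.sum_eq_single 1]
  · simp only [iteratedDeriv_fun_id_zero, Nat.choose_one_right, if_true, mul_one,
      Nat.add_sub_cancel, Nat.factorial_succ]
    push_cast
    have h1 : (n : ℂ) + 1 ≠ 0 := by exact_mod_cast n.succ_ne_zero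
    have h2 : (n.factorial : ℂ) ≠ 0 := by exact_mod_cast n.factorial_ne_zero
    field_simp
  · intro i _ hi
    simp [iteratedDeriv_fun_id_zero, hi]
  · intro h
    simp at h

theorem taylorCoeff_pow_mul_add {g : ℂ → ℂ} (hg : DifferentiableOn ℂ g (ball 0 1)) (n k : ℕ) :
    taylorCoeff (fun z => z ^ k * g z) (n + k) = taylorCoeff g n := by
  induction k with
  | zero => simp
  | succ k ih =>
    have hd : DifferentiableOn ℂ (fun z => z ^ k * g z) (ball 0 1) :=
      (differentiableOn_id.pow k).mul hg
    simpa only [pow_succ', mul_assoc, ← add_assoc, ih] using taylorCoeff_id_mul_succ hd (n + k)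

theorem taylorCoeff_pow_mul_of_lt {g : ℂ → ℂ} (hg : DifferentiableOn ℂ g (ball 0 1)) {n k : ℕ}
    (hn : n < k) : taylorCoeff (fun z => z ^ k * g z) n = 0 := by
  induction k generalizing n with
  | zero => simp at hn
  | succ k ih =>
    have hd : DifferentiableOn ℂ (fun z => z ^ k * g z) (ball 0 1) :=
      (differentiableOn_id.pow k).mul hg
    simp only [pow_succ', mul_assoc]
    cases n with
    | zero => exact taylorCoeff_id_mul_zero _
    | succ n => rw [taylorCoeff_id_mul_succ hd]; exact ih (by omega)

theorem taylorCoeff_pow (k n : ℕ) :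
    taylorCoeff (fun z => z ^ k) n = if n = k then 1 else 0 := by
  unfold taylorCoeff
  rw [iteratedDeriv_fun_pow_zero]
  split_ifs with h
  · subst h
    exact inv_mul_cancel₀ (by exact_mod_cast n.factorial_ne_zero)
  · simp

theorem eq_add_mul_dslope (g : ℂ → ℂ) (z : ℂ) : g z = g 0 + z * dslope g 0 z := by
  have := sub_smul_dslope g 0 z
  rw [sub_zero, smul_eq_mul] at this
  rw [this]; ring

theorem differentiableOn_dslope_disc {g : ℂ → ℂ} (hg : DifferentiableOn ℂ g (ball 0 1)) :
    DifferentiableOn ℂ (dslope g 0) (ball 0 1) :=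
  (Complex.differentiableOn_dslope (ball_mem_nhds 0 one_pos)).2 hg

theorem taylorCoeff_const_succ (c : ℂ) (n : ℕ) : taylorCoeff (fun _ => c) (n + 1) = 0 := by
  simp [taylorCoeff, iteratedDeriv_const]

theorem taylorCoeff_dslope {g : ℂ → ℂ} (hg : DifferentiableOn ℂ g (ball 0 1)) (n : ℕ) :
    taylorCoeff (dslope g 0) n = taylorCoeff g (n + 1) := by
  have hd := differentiableOn_dslope_disc hg
  have h : g = (fun _ => g 0) + fun z => z * dslope g 0 z := funext (eq_add_mul_dslope g)
  conv_rhs => rw [h]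
  rw [taylorCoeff_add (g := fun z => z * dslope g 0 z) (differentiableOn_const _)
      (differentiableOn_id.mul hd),
    taylorCoeff_const_succ, taylorCoeff_id_mul_succ hd, zero_add]

/-! ### Circle averages and Bessel's inequality -/

theorem circleIntegrable_of_continuousOn_disc {E : Type*} [NormedAddCommGroup E] {g : ℂ → E}
    (hg : ContinuousOn g (ball 0 1)) {r : ℝ} (hr0 : 0 ≤ r) (hr : r < 1) :
    CircleIntegrable g 0 r :=
  (hg.mono fun z hz => by
    rw [mem_sphere_zero_iff_norm] at hz
    simpa [hz] using hr).circleIntegrable hr0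

theorem circleAverage_re_of_disc {g : ℂ → ℂ} (hg : DifferentiableOn ℂ g (ball 0 1)) {r : ℝ}
    (hr0 : 0 ≤ r) (hr : r < 1) : Real.circleAverage (fun z => (g z).re) 0 r = (g 0).re := by
  have h1 := Complex.reCLM.circleAverage_comp_comm
    (circleIntegrable_of_continuousOn_disc hg.continuousOn hr0 hr)
  have h2 : Real.circleAverage g 0 r = g 0 := by
    apply DiffContOnCl.circleAverage
    refine (hg.mono ?_).diffContOnCl
    refine closure_ball_subset_closedBall.trans (closedBall_subset_ball ?_)
    rwa [abs_of_nonneg hr0]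
  rw [h2] at h1
  exact h1

/-- **Bessel's inequality** on the circle of radius `r`. -/
theorem sum_taylorCoeff_le_circleAverage {g : ℂ → ℂ} (hg : DifferentiableOn ℂ g (ball 0 1))
    {r : ℝ} (hr0 : 0 ≤ r) (hr : r < 1) (N : ℕ) :
    ∑ n ∈ Finset.range N, ‖taylorCoeff g n‖ ^ 2 * (r ^ 2) ^ n
      ≤ Real.circleAverage (fun z => ‖g z‖ ^ 2) 0 r := by
  induction N generalizing g with
  | zero =>
    simpa using Real.circleAverage_nonneg_of_nonneg fun z _ => sq_nonneg ‖g z‖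
  | succ N ih =>
    have hd := differentiableOn_dslope_disc hg
    have key : Real.circleAverage (fun z => ‖g z‖ ^ 2) 0 r
        = ‖g 0‖ ^ 2 + r ^ 2 * Real.circleAverage (fun z => ‖dslope g 0 z‖ ^ 2) 0 r := by
      -- on the circle, `‖g‖² = ‖g 0‖² + 2 Re (conj (g 0) z g₁) + r² ‖g₁‖²` where `g₁ = dslope g 0`
      have e : Set.EqOn (fun z => ‖g z‖ ^ 2)
          (fun z => (‖g 0‖ ^ 2 + (2 * (starRingEnd ℂ) (g 0) * (z * dslope g 0 z)).re)
            + r ^ 2 * ‖dslope g 0 z‖ ^ 2) (sphere 0 |r|) := by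
        intro z hz
        rw [mem_sphere_zero_iff_norm, abs_of_nonneg hr0] at hz
        simp only
        rw [eq_add_mul_dslope g z, ← hz, ← mul_pow, ← norm_mul]
        simp only [Complex.sq_norm, Complex.normSq_apply, Complex.add_re, Complex.add_im,
          Complex.mul_re, Complex.mul_im, Complex.conj_re, Complex.conj_im, Complex.re_ofNat,
          Complex.im_ofNat]
        ring
      have hc : DifferentiableOn ℂ
          (fun z => 2 * (starRingEnd ℂ) (g 0) * (z * dslope g 0 z)) (ball 0 1) :=
        (differentiableOn_id.mul hd).const_mul _
      have i1 : CircleIntegrable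
          (fun z => (2 * (starRingEnd ℂ) (g 0) * (z * dslope g 0 z)).re) 0 r :=
        circleIntegrable_of_continuousOn_disc
          (Complex.continuous_re.comp_continuousOn hc.continuousOn) hr0 hr
      have i2 : CircleIntegrable (fun z => r ^ 2 * ‖dslope g 0 z‖ ^ 2) 0 r :=
        circleIntegrable_of_continuousOn_disc
          (continuousOn_const.mul (hd.continuousOn.norm.pow 2)) hr0 hr
      have i0 : CircleIntegrable (fun _ => ‖g 0‖ ^ 2) 0 r := circleIntegrable_const _ _ _
      rw [Real.circleAverage_congr_sphere e, Real.circleAverage_fun_add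
          (f₁ := fun z => ‖g 0‖ ^ 2 + (2 * (starRingEnd ℂ) (g 0) * (z * dslope g 0 z)).re)
          (i0.add i1) i2, Real.circleAverage_fun_add i0 i1, circleAverage_re_of_disc hc hr0 hr,
        Real.circleAverage_const]
      have := Real.circleAverage_fun_smul (a := r ^ 2) (c := 0) (R := r)
        (f := fun z => ‖dslope g 0 z‖ ^ 2)
      simp only [smul_eq_mul] at this
      rw [this]
      simp
    rw [Finset.sum_range_succ', key, taylorCoeff_zero_right, pow_zero, mul_one, add_comm]
    gcongr
    refine le_trans (le_of_eq ?_) (mul_le_mul_of_nonneg_left (ih hd) (sq_nonneg r))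
    rw [Finset.mul_sum]
    refine Finset.sum_congr rfl fun n _ => ?_
    rw [taylorCoeff_dslope hg]
    ring

/-! ### Littlewood's harmonic majorant -/

/-- The factor relating the value at `w`, `‖w‖ = x`, of the harmonic majorant of a polynomial to the
sum of the squares of the coefficients. -/
noncomputable def majorantConst (x : ℝ) : ℝ := 2 + 4 * x ^ 2 / (1 - x ^ 2)

/-- Littlewood's harmonic majorant: `‖p‖²` is dominated on the disc by the real part of an entire
function whose values are controlled by the coefficients of the polynomial `p`. The term `‖p w‖²` on
the left of the upper bound is what the induction on the degree consumes. -/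
theorem exists_harmonic_majorant (N : ℕ) (a : ℕ → ℂ) :
    ∃ F : ℂ → ℂ, Differentiable ℂ F ∧
      (∀ w : ℂ, ‖w‖ ≤ 1 → ‖∑ n ∈ Finset.range N, a n * w ^ n‖ ^ 2 ≤ (F w).re) ∧
      ∀ w : ℂ, ‖w‖ < 1 → (F w).re + ‖∑ n ∈ Finset.range N, a n * w ^ n‖ ^ 2
        ≤ majorantConst ‖w‖ * ∑ n ∈ Finset.range N, ‖a n‖ ^ 2 := by
  induction N generalizing a with
  | zero => exact ⟨0, differentiable_const 0, by simp, by simp⟩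
  | succ N ih =>
    obtain ⟨F, hF, h1, h2⟩ := ih fun n => a (n + 1)
    -- with `p = a₀ + w q`, the majorant is `F_q + ‖a₀‖² + 2 conj a₀ w q`
    set q : ℂ → ℂ := fun w => ∑ n ∈ Finset.range N, a (n + 1) * w ^ n with hq
    have hqd : Differentiable ℂ q := by
      rw [hq]; fun_prop
    have hp : ∀ w, ∑ n ∈ Finset.range (N + 1), a n * w ^ n = a 0 + w * q w := by
      intro w
      rw [Finset.sum_range_succ', hq]
      simp only [Finset.mul_sum, pow_zero, mul_one]
      rw [add_comm]
      congr 1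
      exact Finset.sum_congr rfl fun n _ => by ring
    have hsq : ∀ w, ‖a 0 + w * q w‖ ^ 2
        = ‖a 0‖ ^ 2 + (2 * (starRingEnd ℂ) (a 0) * (w * q w)).re + ‖w‖ ^ 2 * ‖q w‖ ^ 2 := by
      intro w
      rw [← mul_pow, ← norm_mul]
      simp only [Complex.sq_norm, Complex.normSq_apply, Complex.add_re, Complex.add_im,
        Complex.mul_re, Complex.mul_im, Complex.conj_re, Complex.conj_im, Complex.re_ofNat,
        Complex.im_ofNat]
      ring
    refine ⟨fun w => F w + ((‖a 0‖ ^ 2 : ℝ) : ℂ) + 2 * (starRingEnd ℂ) (a 0) * (w * q w),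
      by fun_prop, fun w hw => ?_, fun w hw => ?_⟩
    · have h := h1 w hw
      rw [hp, hsq, Complex.add_re, Complex.add_re, Complex.ofReal_re]
      have : ‖w‖ ^ 2 * ‖q w‖ ^ 2 ≤ 1 * ‖q w‖ ^ 2 :=
        mul_le_mul_of_nonneg_right (pow_le_one₀ (norm_nonneg w) hw) (sq_nonneg _)
      change ‖q w‖ ^ 2 ≤ _ at h
      linarith
    · have h := h2 w hw
      change (F w).re + ‖q w‖ ^ 2 ≤ _ at h
      rw [hp, hsq, Complex.add_re, Complex.add_re, Complex.ofReal_re, Finset.sum_range_succ',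
        mul_add]
      have hx : 0 < 1 - ‖w‖ ^ 2 := by nlinarith [norm_nonneg w]
      have hre : (2 * (starRingEnd ℂ) (a 0) * (w * q w)).re ≤ 2 * ‖a 0‖ * (‖w‖ * ‖q w‖) :=
        (Complex.re_le_norm _).trans (le_of_eq (by simp))
      have hM : majorantConst ‖w‖ * ‖a 0‖ ^ 2
          = 2 * ‖a 0‖ ^ 2 + (2 * ‖w‖ * ‖a 0‖) ^ 2 / (1 - ‖w‖ ^ 2) := by
        unfold majorantConst; ring
      -- `4 |a₀| |w| |q| ≤ (1 - |w|²) |q|² + 4 |w|² |a₀|² / (1 - |w|²)`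
      have hamgm : 4 * ‖a 0‖ * (‖w‖ * ‖q w‖)
          ≤ (1 - ‖w‖ ^ 2) * ‖q w‖ ^ 2 + (2 * ‖w‖ * ‖a 0‖) ^ 2 / (1 - ‖w‖ ^ 2) := by
        have : 0 ≤ ((1 - ‖w‖ ^ 2) * ‖q w‖ - 2 * ‖w‖ * ‖a 0‖) ^ 2 / (1 - ‖w‖ ^ 2) := by positivity
        have e : ((1 - ‖w‖ ^ 2) * ‖q w‖ - 2 * ‖w‖ * ‖a 0‖) ^ 2 / (1 - ‖w‖ ^ 2)
            = (1 - ‖w‖ ^ 2) * ‖q w‖ ^ 2 + (2 * ‖w‖ * ‖a 0‖) ^ 2 / (1 - ‖w‖ ^ 2)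
              - 4 * ‖a 0‖ * (‖w‖ * ‖q w‖) := by
          field_simp
          ring
        linarith
      rw [hM]
      linarith

theorem majorantConst_nonneg {x : ℝ} (hx : x ^ 2 < 1) : 0 ≤ majorantConst x := by
  have : 0 < 1 - x ^ 2 := by linarith
  unfold majorantConst
  positivity

/-- Littlewood subordination on circles: if `φ` maps the circle of radius `r` into the disc of
radius `R`, the coefficients of `p ∘ φ` weighted by the powers of `r²` are controlled by those of
`p` weighted by the powers of `R²`. -/
theorem sum_taylorCoeff_comp_le {φ : ℂ → ℂ} (hφ : DifferentiableOn ℂ φ (ball 0 1))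
    {r R : ℝ} (hr0 : 0 ≤ r) (hr : r < 1) (hR : ∀ z, ‖z‖ = r → ‖φ z‖ ≤ R) (h0 : ‖φ 0‖ < R)
    (N D : ℕ) (a : ℕ → ℂ) :
    ∑ n ∈ Finset.range N,
        ‖taylorCoeff (fun z => ∑ k ∈ Finset.range D, a k * φ z ^ k) n‖ ^ 2 * (r ^ 2) ^ n
      ≤ majorantConst (‖φ 0‖ / R) * ∑ k ∈ Finset.range D, ‖a k‖ ^ 2 * (R ^ 2) ^ k := by
  have hR0 : 0 < R := (norm_nonneg _).trans_lt h0
  obtain ⟨F, hF, h1, h2⟩ := exists_harmonic_majorant D fun k => a k * (R : ℂ) ^ k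
  have hRc : (R : ℂ) ≠ 0 := by exact_mod_cast hR0.ne'
  have hp : ∀ w : ℂ, ∑ k ∈ Finset.range D, a k * (R : ℂ) ^ k * (w / R) ^ k
      = ∑ k ∈ Finset.range D, a k * w ^ k := fun w =>
    Finset.sum_congr rfl fun k _ => by rw [mul_assoc, ← mul_pow, mul_div_cancel₀ _ hRc]
  have hnorm : ∀ w : ℂ, ‖w / (R : ℂ)‖ = ‖w‖ / R := fun w => by
    rw [norm_div, Complex.norm_real, Real.norm_of_nonneg hR0.le]
  have hpd : DifferentiableOn ℂ (fun z => ∑ k ∈ Finset.range D, a k * φ z ^ k) (ball 0 1) := by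
    fun_prop
  have hG : DifferentiableOn ℂ (fun z => F (φ z / R)) (ball 0 1) :=
    hF.comp_differentiableOn (hφ.div_const _)
  calc _ ≤ Real.circleAverage
        (fun z => ‖∑ k ∈ Finset.range D, a k * φ z ^ k‖ ^ 2) 0 r :=
        sum_taylorCoeff_le_circleAverage hpd hr0 hr N
    _ ≤ Real.circleAverage (fun z => (F (φ z / R)).re) 0 r := by
        refine Real.circleAverage_mono
          (circleIntegrable_of_continuousOn_disc (hpd.continuousOn.norm.pow 2) hr0 hr)
          (circleIntegrable_of_continuousOn_disc
            (Complex.continuous_re.comp_continuousOn hG.continuousOn) hr0 hr) fun z hz => ?_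
        rw [mem_sphere_zero_iff_norm, abs_of_nonneg hr0] at hz
        have := h1 (φ z / R) (by rw [hnorm]; exact (div_le_one hR0).2 (hR z hz))
        rwa [hp] at this
    _ = (F (φ 0 / R)).re := circleAverage_re_of_disc hG hr0 hr
    _ ≤ _ := by
        have := h2 (φ 0 / R) (by rw [hnorm]; exact (div_lt_one hR0).2 h0)
        rw [hp, hnorm] at this
        refine (le_add_of_nonneg_right (sq_nonneg _)).trans (this.trans (le_of_eq ?_))
        congr 1
        refine Finset.sum_congr rfl fun k _ => ?_
        rw [norm_mul, norm_pow, Complex.norm_real, Real.norm_of_nonneg hR0.le]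
        ring

/-! ### Automorphisms of the disc and the Schwarz–Pick lemma -/

/-- The automorphism `z ↦ (z + a) / (1 + conj a z)` of the disc, which sends `0` to `a`. -/
noncomputable def mobius (a z : ℂ) : ℂ := (z + a) / (1 + (starRingEnd ℂ) a * z)

theorem mobius_denom_ne_zero {a z : ℂ} (ha : ‖a‖ < 1) (hz : ‖z‖ < 1) :
    1 + (starRingEnd ℂ) a * z ≠ 0 := by
  intro h
  have h1 : ‖(starRingEnd ℂ) a * z‖ = 1 := by
    rw [eq_neg_of_add_eq_zero_right h, norm_neg, norm_one]
  rw [norm_mul, RCLike.norm_conj] at h1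
  nlinarith [norm_nonneg a, norm_nonneg z]

theorem one_sub_norm_mobius_sq {a z : ℂ} (ha : ‖a‖ < 1) (hz : ‖z‖ < 1) :
    1 - ‖mobius a z‖ ^ 2
      = (1 - ‖a‖ ^ 2) * (1 - ‖z‖ ^ 2) / ‖1 + (starRingEnd ℂ) a * z‖ ^ 2 := by
  have hd : ‖1 + (starRingEnd ℂ) a * z‖ ^ 2 ≠ 0 :=
    pow_ne_zero 2 (norm_ne_zero_iff.2 (mobius_denom_ne_zero ha hz))
  rw [mobius, norm_div, div_pow, eq_div_iff hd, sub_mul, div_mul_cancel₀ _ hd]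
  simp only [Complex.sq_norm, Complex.normSq_apply, Complex.add_re, Complex.add_im,
    Complex.mul_re, Complex.mul_im, Complex.conj_re, Complex.conj_im, Complex.one_re,
    Complex.one_im]
  ring

theorem norm_mobius_lt_one {a z : ℂ} (ha : ‖a‖ < 1) (hz : ‖z‖ < 1) : ‖mobius a z‖ < 1 := by
  have hd := norm_pos_iff.2 (mobius_denom_ne_zero ha hz)
  have h1 : 0 < 1 - ‖a‖ ^ 2 := by nlinarith [norm_nonneg a]
  have h2 : 0 < 1 - ‖z‖ ^ 2 := by nlinarith [norm_nonneg z]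
  have h : 0 < 1 - ‖mobius a z‖ ^ 2 := by
    rw [one_sub_norm_mobius_sq ha hz]; positivity
  nlinarith [norm_nonneg (mobius a z)]

theorem mapsTo_mobius {a : ℂ} (ha : ‖a‖ < 1) : Set.MapsTo (mobius a) (ball 0 1) (ball 0 1) := by
  intro z hz
  rw [mem_ball_zero_iff] at hz ⊢
  exact norm_mobius_lt_one ha hz

theorem mobius_zero (a : ℂ) : mobius a 0 = a := by simp [mobius]

theorem mobius_neg_self (a : ℂ) : mobius (-a) a = 0 := by simp [mobius]

theorem hasDerivAt_mobius {a z : ℂ} (ha : ‖a‖ < 1) (hz : ‖z‖ < 1) :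
    HasDerivAt (mobius a) (((1 - ‖a‖ ^ 2 : ℝ) : ℂ) / (1 + (starRingEnd ℂ) a * z) ^ 2) z := by
  have hd := mobius_denom_ne_zero ha hz
  have h := ((hasDerivAt_id z).add_const a).div
    (((hasDerivAt_id z).const_mul ((starRingEnd ℂ) a)).const_add 1) hd
  refine h.congr_deriv ?_
  have e : ((‖a‖ ^ 2 : ℝ) : ℂ) = a * (starRingEnd ℂ) a := by
    rw [Complex.mul_conj, Complex.normSq_eq_norm_sq]
  congr 1
  rw [Complex.ofReal_sub, e]
  simp
  ring

theorem differentiableOn_mobius {a : ℂ} (ha : ‖a‖ < 1) :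
    DifferentiableOn ℂ (mobius a) (ball 0 1) := fun _ hz =>
  (hasDerivAt_mobius ha (mem_ball_zero_iff.1 hz)).differentiableAt.differentiableWithinAt

theorem mobius_mobius_neg {a z : ℂ} (ha : ‖a‖ < 1) (hz : ‖z‖ < 1) :
    mobius a (mobius (-a) z) = z := by
  have ha' : ‖-a‖ < 1 := by rwa [norm_neg]
  have hd := mobius_denom_ne_zero ha' hz
  have hd2 := mobius_denom_ne_zero ha (norm_mobius_lt_one ha' hz)
  have hm : mobius (-a) z * (1 + (starRingEnd ℂ) (-a) * z) = z + -a := div_mul_cancel₀ _ hd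
  change (mobius (-a) z + a) / (1 + (starRingEnd ℂ) a * mobius (-a) z) = z
  rw [div_eq_iff hd2]
  refine mul_right_cancel₀ hd ?_
  rw [map_neg] at hm ⊢
  linear_combination (1 - z * (starRingEnd ℂ) a) * hm

/-- A form of the Schwarz–Pick lemma. -/
theorem norm_sq_le_of_mapsTo_disc {φ : ℂ → ℂ} (hφ : DifferentiableOn ℂ φ (ball 0 1))
    (hmap : Set.MapsTo φ (ball 0 1) (ball 0 1)) {z : ℂ} (hz : ‖z‖ < 1) :
    ‖φ z‖ ^ 2 ≤ 1 - (1 - ‖φ 0‖ ^ 2) / 4 * (1 - ‖z‖ ^ 2) := by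
  have hb : ‖φ 0‖ < 1 := mem_ball_zero_iff.1 (hmap (mem_ball_self one_pos))
  have hb' : ‖-φ 0‖ < 1 := by rwa [norm_neg]
  have hφz : ‖φ z‖ < 1 := mem_ball_zero_iff.1 (hmap (mem_ball_zero_iff.2 hz))
  set g : ℂ → ℂ := fun z => mobius (-φ 0) (φ z) with hg
  have hgz : ‖g z‖ ≤ ‖z‖ :=
    Complex.norm_le_norm_of_mapsTo_ball ((differentiableOn_mobius hb').comp hφ hmap)
      (((mapsTo_mobius hb').comp hmap).mono_right ball_subset_closedBall)
      (mobius_neg_self (φ 0)) hz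
  have hgz1 : ‖g z‖ < 1 := hgz.trans_lt hz
  have h := one_sub_norm_mobius_sq hb hgz1
  rw [hg, mobius_mobius_neg hb hφz] at h
  change _ = (1 - ‖φ 0‖ ^ 2) * (1 - ‖g z‖ ^ 2) / ‖1 + (starRingEnd ℂ) (φ 0) * g z‖ ^ 2 at h
  have hd := norm_pos_iff.2 (mobius_denom_ne_zero hb hgz1)
  have hd2 : ‖1 + (starRingEnd ℂ) (φ 0) * g z‖ ≤ 2 := by
    refine (norm_add_le _ _).trans ?_
    rw [norm_one, norm_mul, RCLike.norm_conj]
    nlinarith [norm_nonneg (φ 0), norm_nonneg (g z)]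
  have h1 : 0 ≤ 1 - ‖φ 0‖ ^ 2 := by nlinarith [norm_nonneg (φ 0)]
  have h2 : 0 ≤ 1 - ‖z‖ ^ 2 := by nlinarith [norm_nonneg z]
  have h3 : 1 - ‖z‖ ^ 2 ≤ 1 - ‖g z‖ ^ 2 := by nlinarith [norm_nonneg (g z)]
  have : (1 - ‖φ 0‖ ^ 2) * (1 - ‖z‖ ^ 2) / 2 ^ 2
      ≤ (1 - ‖φ 0‖ ^ 2) * (1 - ‖g z‖ ^ 2) / ‖1 + (starRingEnd ℂ) (φ 0) * g z‖ ^ 2 := by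
    have := mul_nonneg h1 (h2.trans h3)
    gcongr
  linarith

/-! ### Partial sums of the coefficients of a composition -/

theorem majorantConst_mono {x y : ℝ} (hx : 0 ≤ x) (hxy : x ≤ y) (hy : y ^ 2 < 1) :
    majorantConst x ≤ majorantConst y := by
  have h1 : x ^ 2 ≤ y ^ 2 := by gcongr
  have h2 : 0 < 1 - y ^ 2 := by linarith
  unfold majorantConst
  gcongr

/-- The partial sums of the squared coefficients of `p ∘ φ` are controlled by those of `p` smoothed
at the same scale: the inequality of Littlewood on the circle of squared radius `1 - 1 / (N + 2)`,
whose image under `φ` stays in the disc of squared radius `1 - c / (N + 2)`. -/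
theorem exists_partialSum_comp_le {φ : ℂ → ℂ} (hφ : DifferentiableOn ℂ φ (ball 0 1))
    (hmap : Set.MapsTo φ (ball 0 1) (ball 0 1)) :
    ∃ c C : ℝ, 0 < c ∧ c ≤ 1 ∧ 0 ≤ C ∧ ∀ (N D : ℕ) (a : ℕ → ℂ),
      ∑ n ∈ Finset.range (N + 1),
          ‖taylorCoeff (fun z => ∑ k ∈ Finset.range D, a k * φ z ^ k) n‖ ^ 2
        ≤ C * ∑ k ∈ Finset.range D, ‖a k‖ ^ 2 * (1 - c / (N + 2)) ^ k := by
  have hb : ‖φ 0‖ < 1 := mem_ball_zero_iff.1 (hmap (mem_ball_self one_pos))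
  have hb2 : 0 < 1 - ‖φ 0‖ ^ 2 := by nlinarith [norm_nonneg (φ 0)]
  set c : ℝ := (1 - ‖φ 0‖ ^ 2) / 4 with hc
  have hc0 : 0 < c := by positivity
  have hc1 : c ≤ 1 / 4 := by rw [hc]; nlinarith [sq_nonneg ‖φ 0‖]
  have hbc : ‖φ 0‖ ^ 2 < 1 - c := by rw [hc]; linarith
  have hs : 0 < √(1 - c) := Real.sqrt_pos.2 (by linarith)
  have hy : (‖φ 0‖ / √(1 - c)) ^ 2 < 1 := by
    rw [div_pow, Real.sq_sqrt (by linarith), div_lt_one (by linarith)]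
    exact hbc
  refine ⟨c, 3 * majorantConst (‖φ 0‖ / √(1 - c)), hc0, by linarith,
    mul_nonneg (by norm_num) (majorantConst_nonneg hy), fun N D a => ?_⟩
  have hN : (0 : ℝ) < N + 2 := by positivity
  have hN1 : (1 : ℝ) / (N + 2) ≤ 1 / 2 := by
    apply one_div_le_one_div_of_le <;> [norm_num; linarith [(Nat.cast_nonneg N : (0 : ℝ) ≤ N)]]
  have hcN : c / (N + 2) ≤ c := by
    rw [div_eq_mul_one_div]; nlinarith
  have hN0 : (0 : ℝ) < 1 / (N + 2) := by positivity
  have hr2 : √(1 - 1 / ((N : ℝ) + 2)) ^ 2 = 1 - 1 / ((N : ℝ) + 2) := Real.sq_sqrt (by linarith)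
  have hR2 : √(1 - c / ((N : ℝ) + 2)) ^ 2 = 1 - c / ((N : ℝ) + 2) := Real.sq_sqrt (by linarith)
  have hr : √(1 - 1 / ((N : ℝ) + 2)) < 1 := by
    rw [Real.sqrt_lt' one_pos]; linarith
  have hRs : √(1 - c) ≤ √(1 - c / ((N : ℝ) + 2)) := Real.sqrt_le_sqrt (by linarith)
  have main := sum_taylorCoeff_comp_le hφ (r := √(1 - 1 / ((N : ℝ) + 2)))
    (R := √(1 - c / ((N : ℝ) + 2))) (Real.sqrt_nonneg _) hr
    (fun z hz => by
      refine Real.le_sqrt_of_sq_le ((norm_sq_le_of_mapsTo_disc hφ hmap (hz ▸ hr)).trans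
        (le_of_eq ?_))
      rw [hz, hr2, ← hc]
      ring)
    (Real.lt_sqrt_of_sq_lt (by linarith)) (N + 1) D a
  rw [hr2, hR2] at main
  have hM : majorantConst (‖φ 0‖ / √(1 - c / ((N : ℝ) + 2)))
      ≤ majorantConst (‖φ 0‖ / √(1 - c)) :=
    majorantConst_mono (by positivity) (by gcongr) hy
  have hsum : 0 ≤ ∑ k ∈ Finset.range D, ‖a k‖ ^ 2 * (1 - c / ((N : ℝ) + 2)) ^ k :=
    Finset.sum_nonneg fun k _ => mul_nonneg (sq_nonneg _) (pow_nonneg (by linarith) k)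
  have main := main.trans (mul_le_mul_of_nonneg_right hM hsum)
  -- `(1 - 1 / (N + 2)) ^ n ≥ 1 / e` for `n ≤ N`
  have hpow : ∀ n ∈ Finset.range (N + 1), 1 ≤ 3 * (1 - 1 / ((N : ℝ) + 2)) ^ n := by
    intro n hn
    have hnN : n ≤ N := Nat.lt_succ_iff.1 (Finset.mem_range.1 hn)
    have h1 : (1 - 1 / ((N : ℝ) + 2)) ^ N ≤ (1 - 1 / ((N : ℝ) + 2)) ^ n :=
      pow_le_pow_of_le_one (by linarith) (by linarith) hnN
    have e : 1 - 1 / ((N : ℝ) + 2) = (1 + 1 / ((N : ℝ) + 1))⁻¹ := by field_simp; ring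
    have h2 : (1 + 1 / ((N : ℝ) + 1)) ^ N ≤ 3 := by
      calc (1 + 1 / ((N : ℝ) + 1)) ^ N ≤ Real.exp (1 / ((N : ℝ) + 1)) ^ N := by
            gcongr
            linarith [Real.add_one_le_exp (1 / ((N : ℝ) + 1))]
        _ = Real.exp (N * (1 / ((N : ℝ) + 1))) := (Real.exp_nat_mul _ _).symm
        _ ≤ Real.exp 1 := by
            apply Real.exp_le_exp.2
            rw [mul_one_div, div_le_one (by positivity)]
            linarith
        _ ≤ 3 := Real.exp_one_lt_three.le
    have h3 : 3⁻¹ ≤ (1 - 1 / ((N : ℝ) + 2)) ^ N := by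
      rw [e, inv_pow]
      exact inv_anti₀ (by positivity) h2
    linarith
  calc _ ≤ ∑ n ∈ Finset.range (N + 1), 3 *
        (‖taylorCoeff (fun z => ∑ k ∈ Finset.range D, a k * φ z ^ k) n‖ ^ 2
          * (1 - 1 / ((N : ℝ) + 2)) ^ n) := by
        refine Finset.sum_le_sum fun n hn => ?_
        nlinarith [mul_le_mul_of_nonneg_left (hpow n hn) (sq_nonneg
          ‖taylorCoeff (fun z => ∑ k ∈ Finset.range D, a k * φ z ^ k) n‖)]
    _ ≤ _ := by
        rw [← Finset.mul_sum, mul_assoc]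
        linarith

/-! ### The weights -/

theorem bergmanWeight_succ {α : ℝ} (hα : -1 ≤ α) (n : ℕ) :
    bergmanWeight α (n + 1) = bergmanWeight α n * ((n + 1) / (n + 2 + α)) := by
  have hn : (0 : ℝ) ≤ n := Nat.cast_nonneg n
  have h0 : (n : ℝ) + 2 + α ≠ 0 := by linarith
  have h1 : Real.Gamma (n + 2 + α) ≠ 0 := (Real.Gamma_pos_of_pos (by linarith)).ne'
  have e : ((n + 1 : ℕ) : ℝ) + 2 + α = (n + 2 + α) + 1 := by push_cast; ring
  unfold bergmanWeight
  rw [e, Real.Gamma_add_one h0, Nat.factorial_succ]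
  push_cast
  field_simp

theorem bergmanWeight_antitone {α : ℝ} (hα : -1 ≤ α) : Antitone (bergmanWeight α) := by
  refine antitone_nat_of_succ_le fun n => ?_
  rw [bergmanWeight_succ hα]
  have hn : (0 : ℝ) ≤ n := Nat.cast_nonneg n
  refine mul_le_of_le_one_right (bergmanWeight_pos hα n).le ?_
  rw [div_le_one (by linarith)]
  linarith

theorem bergmanWeight_mul_pow_mono {α : ℝ} (hα : -1 ≤ α) {p : ℕ} (hp : α + 1 ≤ p) :
    Monotone fun n : ℕ => bergmanWeight α n * ((n : ℝ) + 1) ^ p := by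
  refine monotone_nat_of_le_succ fun n => ?_
  have hn : (0 : ℝ) ≤ n := Nat.cast_nonneg n
  have hw := bergmanWeight_pos hα n
  rw [bergmanWeight_succ hα, mul_assoc]
  refine mul_le_mul_of_nonneg_left ?_ hw.le
  -- Bernoulli's inequality for `(1 + 1 / (n + 1)) ^ p`
  have hB : 1 + (p : ℝ) * (1 / (n + 1)) ≤ (1 + 1 / ((n : ℝ) + 1)) ^ p :=
    one_add_mul_le_pow (by have : (0 : ℝ) ≤ 1 / (n + 1) := by positivity
                           linarith) p
  have h1 : ((n : ℝ) + 2 + α) / (n + 1) ≤ (1 + 1 / ((n : ℝ) + 1)) ^ p := by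
    refine le_trans ?_ hB
    rw [div_le_iff₀ (by positivity), add_mul, mul_assoc, one_div_mul_cancel (by positivity)]
    linarith
  have e : 1 + 1 / ((n : ℝ) + 1) = (((n + 1 : ℕ) : ℝ) + 1) / (n + 1) := by
    push_cast; field_simp
  rw [e, div_pow, le_div_iff₀ (by positivity)] at h1
  have h2 : (0 : ℝ) < (n + 1) / (n + 2 + α) := div_pos (by linarith) (by linarith)
  calc ((n : ℝ) + 1) ^ p
      = (n + 1) / (n + 2 + α) * (((n : ℝ) + 2 + α) / (n + 1) * (n + 1) ^ p) := by
        have : (n : ℝ) + 2 + α ≠ 0 := by linarith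
        field_simp
    _ ≤ _ := mul_le_mul_of_nonneg_left h1 h2.le

/-- The exponential decay of `(1 - c / (N + 2)) ^ n` in `n / N` beats the polynomial growth of the
ratio of the weights at `N` and `n`, with one power to spare. -/
theorem exists_bergmanWeight_mul_pow_le {α : ℝ} (hα : -1 ≤ α) {c : ℝ} (hc0 : 0 < c)
    (hc1 : c ≤ 1) : ∃ K : ℝ, 0 ≤ K ∧ ∀ N n : ℕ, N ≤ n →
      bergmanWeight α N * (1 - c / (N + 2)) ^ n
        ≤ K * bergmanWeight α n * ((N + 2) / (n + 1)) := by
  obtain ⟨p, hp⟩ := exists_nat_ge (α + 1)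
  refine ⟨2 ^ (p + 1) * (p + 1).factorial / c ^ (p + 1), by positivity, fun N n hNn => ?_⟩
  have hN : (0 : ℝ) ≤ N := Nat.cast_nonneg N
  have hn : (0 : ℝ) ≤ n := Nat.cast_nonneg n
  have hwN := bergmanWeight_pos hα N
  have hwn := bergmanWeight_pos hα n
  set x : ℝ := (n + 1) / (N + 2) with hx
  have hx0 : 0 < x := by positivity
  have hcN : c / (N + 2) ≤ 1 / 2 := by
    rw [div_le_div_iff₀ (by positivity) (by norm_num)]; linarith
  have hcN0 : 0 < c / ((N : ℝ) + 2) := by positivity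
  have h1 : bergmanWeight α N ≤ bergmanWeight α n * (2 * x) ^ p := by
    have h := bergmanWeight_mul_pow_mono hα hp hNn
    simp only at h
    rw [← le_div_iff₀ (by positivity), mul_div_assoc, ← div_pow] at h
    refine h.trans ?_
    gcongr
    rw [hx, ← mul_div_assoc, div_le_div_iff₀ (by positivity) (by positivity)]
    nlinarith
  have h2 : (1 - c / ((N : ℝ) + 2)) ^ n ≤ 2 * ((p + 1).factorial / (c * x) ^ (p + 1)) := by
    have e1 : (1 - c / ((N : ℝ) + 2)) ^ n ≤ 2 * (1 - c / ((N : ℝ) + 2)) ^ (n + 1) := by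
      have : 0 ≤ (1 - c / ((N : ℝ) + 2)) ^ n := pow_nonneg (by linarith) n
      rw [pow_succ]
      nlinarith
    have e2 : (1 - c / ((N : ℝ) + 2)) ^ (n + 1) ≤ Real.exp (-(c * x)) := by
      calc _ ≤ Real.exp (-(c / ((N : ℝ) + 2))) ^ (n + 1) := by
            refine pow_le_pow_left₀ (by linarith) ?_ _
            linarith [Real.add_one_le_exp (-(c / ((N : ℝ) + 2)))]
        _ = Real.exp (-(c * x)) := by
            rw [← Real.exp_nat_mul]
            congr 1
            rw [hx]
            push_cast
            ring
    have e3 : Real.exp (-(c * x)) ≤ (p + 1).factorial / (c * x) ^ (p + 1) := by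
      have := Real.pow_div_factorial_le_exp (c * x) (by positivity) (p + 1)
      rw [Real.exp_neg, inv_le_comm₀ (Real.exp_pos _) (by positivity), inv_div]
      exact this
    linarith
  calc _ ≤ bergmanWeight α n * (2 * x) ^ p * (2 * ((p + 1).factorial / (c * x) ^ (p + 1))) :=
        mul_le_mul h1 h2 (pow_nonneg (by linarith) n) (by positivity)
    _ = 2 ^ (p + 1) * (p + 1).factorial / c ^ (p + 1) * bergmanWeight α n * x⁻¹ := by
        simp only [mul_pow, pow_succ]
        field_simp
    _ = _ := by rw [hx, inv_div]

/-- Averaging the powers of `1 - c / (N + 2)` against the differences of the weights reproduces the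
weights up to a constant. -/
theorem exists_sum_bergmanWeight_sub_mul_pow_le {α : ℝ} (hα : -1 ≤ α) {c : ℝ} (hc0 : 0 < c)
    (hc1 : c ≤ 1) : ∃ K : ℝ, 0 ≤ K ∧ ∀ M n : ℕ,
      bergmanWeight α M * (1 - c / (M + 2)) ^ n + ∑ N ∈ Finset.range M,
          (bergmanWeight α N - bergmanWeight α (N + 1)) * (1 - c / (N + 2)) ^ n
        ≤ K * bergmanWeight α n := by
  obtain ⟨K, hK, hKb⟩ := exists_bergmanWeight_mul_pow_le hα hc0 hc1
  have hρ : ∀ N : ℕ, 0 ≤ 1 - c / ((N : ℝ) + 2) := fun N => by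
    rw [sub_nonneg, div_le_one (by positivity)]
    linarith [(Nat.cast_nonneg N : (0 : ℝ) ≤ N)]
  have hρ1 : ∀ N : ℕ, 1 - c / ((N : ℝ) + 2) ≤ 1 := fun N => by
    have : 0 ≤ c / ((N : ℝ) + 2) := by positivity
    linarith
  refine ⟨2 * K + 1 + 2 * (α + 1) * K, by nlinarith, fun M n => ?_⟩
  have hwn := bergmanWeight_pos hα n
  have hn0 : (0 : ℝ) ≤ n := Nat.cast_nonneg n
  have hα1 : 0 ≤ α + 1 := by linarith
  have hfirst : bergmanWeight α M * (1 - c / (M + 2)) ^ n ≤ (2 * K + 1) * bergmanWeight α n := by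
    rcases le_total M n with h | h
    · refine (hKb M n h).trans ?_
      have : ((M : ℝ) + 2) / (n + 1) ≤ 2 := by
        rw [div_le_iff₀ (by positivity)]
        have : (M : ℝ) ≤ n := by exact_mod_cast h
        linarith
      nlinarith [mul_le_mul_of_nonneg_left this (mul_nonneg hK hwn.le)]
    · have h1 : (1 - c / ((M : ℝ) + 2)) ^ n ≤ 1 := pow_le_one₀ (hρ M) (hρ1 M)
      have h2 := bergmanWeight_antitone hα h
      nlinarith [mul_le_mul_of_nonneg_left h1 (bergmanWeight_pos hα M).le, mul_nonneg hK hwn.le]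
  -- the terms with `N ≤ n` are at most a constant multiple of `wₙ / (n + 1)`
  have hterm : ∀ N : ℕ, N ≤ n →
      (bergmanWeight α N - bergmanWeight α (N + 1)) * (1 - c / (N + 2)) ^ n
        ≤ 2 * (α + 1) * K * bergmanWeight α n / (n + 1) := by
    intro N hN
    have hN0 : (0 : ℝ) ≤ N := Nat.cast_nonneg N
    have hNα : 0 < (N : ℝ) + 2 + α := by linarith
    have e : (bergmanWeight α N - bergmanWeight α (N + 1)) * (1 - c / ((N : ℝ) + 2)) ^ n
        = (α + 1) / (N + 2 + α) * (bergmanWeight α N * (1 - c / (N + 2)) ^ n) := by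
      rw [bergmanWeight_succ hα]
      field_simp
      ring
    have h1 : ((N : ℝ) + 2) / (N + 2 + α) ≤ 2 := by
      rw [div_le_iff₀ hNα]; linarith
    rw [e]
    calc _ ≤ (α + 1) / (N + 2 + α) * (K * bergmanWeight α n * ((N + 2) / (n + 1))) :=
          mul_le_mul_of_nonneg_left (hKb N n hN) (by positivity)
      _ = ((N : ℝ) + 2) / (N + 2 + α) * ((α + 1) * K * bergmanWeight α n / (n + 1)) := by ring
      _ ≤ 2 * ((α + 1) * K * bergmanWeight α n / (n + 1)) :=
          mul_le_mul_of_nonneg_right h1 (by positivity)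
      _ = _ := by ring
  have hL0 : 0 ≤ 2 * (α + 1) * K * bergmanWeight α n := by positivity
  have hsmall : ∀ M : ℕ, M ≤ n → ∑ N ∈ Finset.range M,
      (bergmanWeight α N - bergmanWeight α (N + 1)) * (1 - c / (N + 2)) ^ n
        ≤ 2 * (α + 1) * K * bergmanWeight α n := by
    intro M hM
    refine (Finset.sum_le_card_nsmul _ _ _ fun N hN =>
      hterm N ((Finset.mem_range.1 hN).le.trans hM)).trans ?_
    rw [Finset.card_range, nsmul_eq_mul, ← mul_div_assoc, div_le_iff₀ (by positivity), mul_comm]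
    have : (M : ℝ) ≤ n := by exact_mod_cast hM
    gcongr
    linarith
  have hlarge : ∀ M : ℕ, n ≤ M → ∑ N ∈ Finset.range M,
      (bergmanWeight α N - bergmanWeight α (N + 1)) * (1 - c / (N + 2)) ^ n
        ≤ 2 * (α + 1) * K * bergmanWeight α n + (bergmanWeight α n - bergmanWeight α M) := by
    intro M hM
    induction M, hM using Nat.le_induction with
    | base => simpa using hsmall n le_rfl
    | succ M hM ih =>
      rw [Finset.sum_range_succ]
      have h1 : (1 - c / ((M : ℝ) + 2)) ^ n ≤ 1 := pow_le_one₀ (hρ M) (hρ1 M)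
      have h2 := bergmanWeight_antitone hα (Nat.le_succ M)
      nlinarith [mul_le_mul_of_nonneg_left h1 (sub_nonneg.2 h2)]
  rcases le_total M n with h | h
  · linarith [hsmall M h]
  · have h1 : (1 - c / ((M : ℝ) + 2)) ^ n ≤ 1 := pow_le_one₀ (hρ M) (hρ1 M)
    have h2 := mul_le_mul_of_nonneg_left h1 (bergmanWeight_pos hα M).le
    linarith [hlarge M h, mul_nonneg hK hwn.le]

/-! ### Boundedness of composition operators -/

theorem sum_mul_eq_summation_by_parts (w x : ℕ → ℝ) (M : ℕ) :
    ∑ n ∈ Finset.range (M + 1), w n * x n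
      = w M * ∑ n ∈ Finset.range (M + 1), x n
        + ∑ N ∈ Finset.range M, (w N - w (N + 1)) * ∑ n ∈ Finset.range (N + 1), x n := by
  induction M with
  | zero => simp
  | succ M ih =>
    rw [Finset.sum_range_succ, ih, Finset.sum_range_succ (fun N => (w N - w (N + 1)) * _) M,
      Finset.sum_range_succ x (M + 1)]
    ring

/-- Boundedness of the composition with `φ` on polynomials, for the truncated norm, with a constant
independent of the truncation and of the degree. -/
theorem exists_weightedSum_comp_polynomial_le {α : ℝ} (hα : -1 ≤ α) {φ : ℂ → ℂ}
    (hφ : DifferentiableOn ℂ φ (ball 0 1)) (hmap : Set.MapsTo φ (ball 0 1) (ball 0 1)) :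
    ∃ K : ℝ, 0 ≤ K ∧ ∀ (M D : ℕ) (a : ℕ → ℂ),
      ∑ n ∈ Finset.range (M + 1), bergmanWeight α n *
          ‖taylorCoeff (fun z => ∑ k ∈ Finset.range D, a k * φ z ^ k) n‖ ^ 2
        ≤ K * ∑ k ∈ Finset.range D, bergmanWeight α k * ‖a k‖ ^ 2 := by
  obtain ⟨c, C, hc0, hc1, hC, hS⟩ := exists_partialSum_comp_le hφ hmap
  obtain ⟨K, hK, hKb⟩ := exists_sum_bergmanWeight_sub_mul_pow_le hα hc0 hc1
  refine ⟨C * K, mul_nonneg hC hK, fun M D a => ?_⟩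
  rw [sum_mul_eq_summation_by_parts]
  calc _ ≤ bergmanWeight α M * (C * ∑ k ∈ Finset.range D, ‖a k‖ ^ 2 * (1 - c / (M + 2)) ^ k)
        + ∑ N ∈ Finset.range M, (bergmanWeight α N - bergmanWeight α (N + 1))
            * (C * ∑ k ∈ Finset.range D, ‖a k‖ ^ 2 * (1 - c / (N + 2)) ^ k) := by
        refine add_le_add (mul_le_mul_of_nonneg_left (hS M D a) (bergmanWeight_pos hα M).le)
          (Finset.sum_le_sum fun N _ => mul_le_mul_of_nonneg_left (hS N D a)
            (sub_nonneg.2 (bergmanWeight_antitone hα N.le_succ)))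
    _ = C * ∑ k ∈ Finset.range D, ‖a k‖ ^ 2 * (bergmanWeight α M * (1 - c / (M + 2)) ^ k
        + ∑ N ∈ Finset.range M,
          (bergmanWeight α N - bergmanWeight α (N + 1)) * (1 - c / (N + 2)) ^ k) := by
        simp only [mul_add, Finset.sum_add_distrib, Finset.mul_sum]
        congr 1
        · exact Finset.sum_congr rfl fun k _ => by ring
        · rw [Finset.sum_comm]
          exact Finset.sum_congr rfl fun k _ => Finset.sum_congr rfl fun N _ => by ring
    _ ≤ C * ∑ k ∈ Finset.range D, ‖a k‖ ^ 2 * (K * bergmanWeight α k) := by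
        gcongr with k hk
        exact hKb M k
    _ = _ := by
        rw [mul_assoc, Finset.mul_sum _ _ K]
        congr 1
        exact Finset.sum_congr rfl fun k _ => by ring

theorem tendstoLocallyUniformlyOn_iteratedDeriv {ι : Type*} {l : Filter ι} [l.NeBot]
    {F : ι → ℂ → ℂ} {f : ℂ → ℂ} {U : Set ℂ} (hU : IsOpen U)
    (h : TendstoLocallyUniformlyOn F f l U) (hF : ∀ i, DifferentiableOn ℂ (F i) U) (n : ℕ) :
    TendstoLocallyUniformlyOn (fun i => iteratedDeriv n (F i)) (iteratedDeriv n f) l U ∧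
      ∀ i, DifferentiableOn ℂ (iteratedDeriv n (F i)) U := by
  induction n with
  | zero => simpa using ⟨h, hF⟩
  | succ n ih =>
    simp only [iteratedDeriv_succ]
    exact ⟨ih.1.deriv (Eventually.of_forall ih.2) hU, fun i => (ih.2 i).deriv hU⟩

theorem tendsto_taylorCoeff {ι : Type*} {l : Filter ι} [l.NeBot]
    {F : ι → ℂ → ℂ} {f : ℂ → ℂ} (h : TendstoLocallyUniformlyOn F f l (ball 0 1))
    (hF : ∀ i, DifferentiableOn ℂ (F i) (ball 0 1)) (n : ℕ) :
    Tendsto (fun i => taylorCoeff (F i) n) l (nhds (taylorCoeff f n)) :=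
  ((tendstoLocallyUniformlyOn_iteratedDeriv isOpen_ball h hF n).1.tendsto_at
    (mem_ball_self one_pos)).const_mul _

theorem tendstoLocallyUniformlyOn_taylor {f : ℂ → ℂ} (hf : DifferentiableOn ℂ f (ball 0 1)) :
    TendstoLocallyUniformlyOn (fun D z => ∑ k ∈ Finset.range D, taylorCoeff f k * z ^ k) f atTop
      (ball 0 1) := by
  intro u hu x hx
  rw [mem_ball_zero_iff] at hx
  obtain ⟨s, hxs, hs⟩ := exists_between hx
  have hs0 : 0 ≤ s := (norm_nonneg x).trans hxs.le
  have hsc : (s : ℂ) ∈ ball (0 : ℂ) 1 := by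
    rwa [mem_ball_zero_iff, Complex.norm_real, Real.norm_of_nonneg hs0]
  have hsum : ∀ z ∈ ball (0 : ℂ) 1, HasSum (fun k => taylorCoeff f k * z ^ k) (f z) := by
    intro z hz
    refine (Complex.hasSum_taylorSeries_on_ball hf hz).congr_fun fun k => ?_
    simp only [taylorCoeff, smul_eq_mul, sub_zero]
    ring
  have hunif := tendstoUniformlyOn_tsum_nat (hsum s hsc).summable.norm
    (f := fun k z => taylorCoeff f k * z ^ k) (s := ball 0 s) fun k z hz => by
      rw [norm_mul, norm_mul, norm_pow, norm_pow, Complex.norm_real, Real.norm_of_nonneg hs0]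
      gcongr
      exact (mem_ball_zero_iff.1 hz).le
  refine ⟨ball 0 s, mem_nhdsWithin_of_mem_nhds
    (isOpen_ball.mem_nhds (mem_ball_zero_iff.2 hxs)), ?_⟩
  filter_upwards [hunif u hu] with D hD y hy
  have := hD y hy
  rwa [(hsum y (ball_subset_ball hs.le hy)).tsum_eq] at this

/-- The composition of an element of the space with an analytic self-map of the disc is in the
space, with a norm controlled by that of the element. -/
theorem exists_weightedSum_comp_le {α : ℝ} (hα : -1 ≤ α) {φ : ℂ → ℂ}
    (hφ : DifferentiableOn ℂ φ (ball 0 1)) (hmap : Set.MapsTo φ (ball 0 1) (ball 0 1)) :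
    ∃ K : ℝ, 0 ≤ K ∧ ∀ f : BergmanSpace α hα,
      (Summable fun n => bergmanWeight α n * ‖taylorCoeff (fun z => f (φ z)) n‖ ^ 2) ∧
      ∑' n, bergmanWeight α n * ‖taylorCoeff (fun z => f (φ z)) n‖ ^ 2 ≤ K * ‖f‖ ^ 2 := by
  obtain ⟨K, hK, hKb⟩ := exists_weightedSum_comp_polynomial_le hα hφ hmap
  refine ⟨K, hK, fun f => ?_⟩
  have hlim : TendstoLocallyUniformlyOn
      (fun D z => ∑ k ∈ Finset.range D, taylorCoeff f k * φ z ^ k) (fun z => f (φ z)) atTop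
      (ball 0 1) :=
    (tendstoLocallyUniformlyOn_taylor f.2.1).comp φ hmap hφ.continuousOn
  have hcoeff := tendsto_taylorCoeff hlim fun D => by fun_prop
  have hnn : ∀ n, 0 ≤ bergmanWeight α n * ‖taylorCoeff (fun z => f (φ z)) n‖ ^ 2 := fun n =>
    mul_nonneg (bergmanWeight_pos hα n).le (sq_nonneg _)
  have hpart : ∀ M, ∑ n ∈ Finset.range M,
      bergmanWeight α n * ‖taylorCoeff (fun z => f (φ z)) n‖ ^ 2 ≤ K * ‖f‖ ^ 2 := by
    intro M
    refine (Finset.sum_le_sum_of_subset_of_nonneg (Finset.range_mono M.le_succ)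
      fun n _ _ => hnn n).trans ?_
    refine le_of_tendsto' (tendsto_finsetSum _ fun n _ =>
      (((hcoeff n).norm.pow 2).const_mul (bergmanWeight α n))) fun D => ?_
    refine (hKb M D _).trans (mul_le_mul_of_nonneg_left ?_ hK)
    rw [BergmanSpace.norm_sq_eq]
    exact f.2.2.2.sum_le_tsum _ fun n _ =>
      mul_nonneg (bergmanWeight_pos hα n).le (sq_nonneg _)
  exact ⟨summable_of_sum_range_le hnn hpart, Real.tsum_le_of_sum_range_le hnn hpart⟩

theorem exists_compositionOperator {α : ℝ} (hα : -1 ≤ α) {φ : ℂ → ℂ}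
    (hφ : DifferentiableOn ℂ φ (ball 0 1)) (hmap : Set.MapsTo φ (ball 0 1) (ball 0 1)) :
    ∃ C : BergmanSpace α hα →L[ℂ] BergmanSpace α hα, IsCompositionOperator φ C := by
  obtain ⟨K, hK, hKb⟩ := exists_weightedSum_comp_le hα hφ hmap
  have heq : ∀ f : ℂ → ℂ, Set.EqOn ((ball (0 : ℂ) 1).indicator fun z => f (φ z))
      (fun z => f (φ z)) (ball 0 1) := fun f => Set.eqOn_indicator
  let T : BergmanSpace α hα → BergmanSpace α hα := fun f =>
    ⟨(ball (0 : ℂ) 1).indicator fun z => f (φ z),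
      (f.2.1.comp hφ hmap).congr (heq f), fun z hz => Set.indicator_of_notMem hz _, by
        simpa only [taylorCoeff_congr (heq f)] using (hKb f).1⟩
  have hT : ∀ f, ∀ z ∈ ball (0 : ℂ) 1, T f z = f (φ z) := fun f z hz => heq f hz
  let L : BergmanSpace α hα →ₗ[ℂ] BergmanSpace α hα :=
    { toFun := T
      map_add' := fun f g => BergmanSpace.ext fun z hz => by
        change T (f + g) z = T f z + T g z
        rw [hT _ z hz, hT _ z hz, hT _ z hz]
        rfl
      map_smul' := fun c f => BergmanSpace.ext fun z hz => by
        change T (c • f) z = c * T f z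
        rw [hT _ z hz, hT _ z hz]
        rfl }
  refine ⟨L.mkContinuous (√K) fun f => ?_, hT⟩
  refine le_of_sq_le_sq ?_ (by positivity)
  rw [mul_pow, Real.sq_sqrt hK, BergmanSpace.norm_sq_eq]
  change ∑' n, bergmanWeight α n * ‖taylorCoeff (T f) n‖ ^ 2 ≤ _
  have e : ∀ n, taylorCoeff (T f) n = taylorCoeff (fun z => f (φ z)) n :=
    taylorCoeff_congr (heq f)
  simpa only [e] using (hKb f).2

/-! ### Distance of a triangular operator to operators of small rank -/

open scoped InnerProductSpace in
/-- **Hadamard's inequality** for the determinant of an endomorphism, by the Gram–Schmidt process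
applied to the images of an orthonormal basis. -/
theorem norm_linearMap_det_le_prod {n : ℕ} {E : Type*} [NormedAddCommGroup E]
    [InnerProductSpace ℂ E] [FiniteDimensional ℂ E] (b : OrthonormalBasis (Fin n) ℂ E)
    (A : E →ₗ[ℂ] E) : ‖LinearMap.det A‖ ≤ ∏ i, ‖A (b i)‖ := by
  have hn : Module.finrank ℂ E = Fintype.card (Fin n) := Module.finrank_eq_card_basis b.toBasis
  set v : Fin n → E := fun i => A (b i) with hv
  set g := InnerProductSpace.gramSchmidtOrthonormalBasis hn v with hg
  have h1 : LinearMap.det A = b.toBasis.det v := by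
    have h := b.toBasis.det_comp A b.toBasis
    rw [b.toBasis.det_self, mul_one] at h
    rw [← h]
    congr 1
  have h2 : b.toBasis.det v = b.toBasis.det g * g.toBasis.det v := by
    rw [Module.Basis.det_apply, Module.Basis.det_apply, Module.Basis.det_apply, ← Matrix.det_mul,
      ← OrthonormalBasis.coe_toBasis g, Module.Basis.toMatrix_mul_toMatrix]
  rw [h1, h2, norm_mul, OrthonormalBasis.det_to_matrix_orthonormalBasis, one_mul, hg,
    InnerProductSpace.gramSchmidtOrthonormalBasis_det, norm_prod]
  refine Finset.prod_le_prod (fun _ _ => norm_nonneg _) fun i _ => ?_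
  refine (norm_inner_le_norm _ _).trans (le_of_eq ?_)
  rw [OrthonormalBasis.norm_eq_one, one_mul]

/-- In dimension `2m`, a perturbation `R` of rank less than `m` vanishes on `m` vectors of some
orthonormal basis, on which the operator `A` is therefore no larger than `A - R`. -/
theorem norm_det_le_of_finrank_range_lt {m : ℕ} {E : Type*} [NormedAddCommGroup E]
    [InnerProductSpace ℂ E] [FiniteDimensional ℂ E] (hE : Module.finrank ℂ E = m + m)
    (A R : E →L[ℂ] E) (hR : Module.finrank ℂ (LinearMap.range (R : E →ₗ[ℂ] E)) < m) :
    ‖LinearMap.det (A : E →ₗ[ℂ] E)‖ ≤ ‖A - R‖ ^ m * ‖A‖ ^ m := by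
  set K := LinearMap.ker (R : E →ₗ[ℂ] E) with hK
  have hKm : m ≤ Module.finrank ℂ K := by
    have := LinearMap.finrank_range_add_finrank_ker (R : E →ₗ[ℂ] E)
    rw [← hK] at this
    omega
  let u := stdOrthonormalBasis ℂ K
  let v : Fin (m + m) → E := Fin.addCases (fun i => (u (Fin.castLE hKm i) : E)) fun _ => 0
  have hvl : ∀ i : Fin m, v (Fin.castAdd m i) = (u (Fin.castLE hKm i) : E) := fun i =>
    Fin.addCases_left i
  have hu : Orthonormal ℂ fun i : Fin m => (u (Fin.castLE hKm i) : E) :=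
    (u.orthonormal.comp_linearIsometry K.subtypeₗᵢ).comp _ (Fin.castLE_injective hKm)
  have hv : Orthonormal ℂ ((Set.range (Fin.castAdd m : Fin m → Fin (m + m))).domRestrict v) := by
    have e : ∀ x : Set.range (Fin.castAdd m : Fin m → Fin (m + m)),
        ∃ i : Fin m, Fin.castAdd m i = x := fun x => x.2
    choose f hf using e
    have hfi : Function.Injective f := fun x y h => Subtype.ext (by rw [← hf x, ← hf y, h])
    convert hu.comp f hfi using 1
    ext x
    rw [Set.domRestrict_apply, ← hf x, hvl]
    rfl
  obtain ⟨b, hb⟩ := hv.exists_orthonormalBasis_extension_of_card_eq (by simpa using hE)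
  refine (norm_linearMap_det_le_prod b (A : E →ₗ[ℂ] E)).trans ?_
  rw [Fin.prod_univ_add]
  refine mul_le_mul ?_ ?_ (by positivity) (by positivity)
  · refine (Finset.prod_le_prod (g := fun _ => ‖A - R‖) (fun _ _ => norm_nonneg _)
      fun i _ => ?_).trans (by simp)
    have h0 : R (b (Fin.castAdd m i)) = 0 := by
      rw [hb _ ⟨i, rfl⟩, hvl]
      exact (u (Fin.castLE hKm i)).2
    have h := (A - R).le_opNorm (b (Fin.castAdd m i))
    rw [OrthonormalBasis.norm_eq_one, mul_one, _root_.sub_apply, h0, sub_zero] at h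
    exact h
  · refine (Finset.prod_le_prod (g := fun _ => ‖A‖) (fun _ _ => norm_nonneg _)
      fun i _ => ?_).trans (by simp)
    have h := A.le_opNorm (b (Fin.natAdd m i))
    rwa [OrthonormalBasis.norm_eq_one, mul_one] at h

open scoped InnerProductSpace in
/-- If the matrix of `T` in an orthonormal sequence is triangular with diagonal `1, μ, μ², …`, the
distance of `T` to the operators of rank less than `m` is at least of order `|μ|^{2m}`: compress
to the first `2m` vectors and compare determinants. -/
theorem norm_pow_le_norm_sub_mul_norm {H : Type*} [NormedAddCommGroup H] [InnerProductSpace ℂ H]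
    {e : ℕ → H} (he : Orthonormal ℂ e) (T : H →L[ℂ] H) {μ : ℂ} (hμ : ‖μ‖ ≤ 1)
    (hlow : ∀ j k, j < k → ⟪e j, T (e k)⟫_ℂ = 0) (hdiag : ∀ k, ⟪e k, T (e k)⟫_ℂ = μ ^ k)
    {m : ℕ} (hm : 1 ≤ m) (R : H →L[ℂ] H) (hR : (R : H →ₗ[ℂ] H).rank < m) :
    ‖μ‖ ^ (2 * m) ≤ ‖T - R‖ * ‖T‖ := by
  have hev : Orthonormal ℂ fun i : Fin (m + m) => e i := he.comp _ Fin.val_injective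
  set V := Submodule.span ℂ (Set.range fun i : Fin (m + m) => e i) with hV
  have : FiniteDimensional ℂ V := FiniteDimensional.span_of_finite ℂ (Set.finite_range _)
  let b₀ := Module.Basis.span hev.linearIndependent
  have hb₀ : ∀ i, (b₀ i : H) = e i := fun i =>
    congrArg Subtype.val (Module.Basis.span_apply hev.linearIndependent i)
  have hb₀o : Orthonormal ℂ b₀ := by
    rw [← V.subtypeₗᵢ.orthonormal_comp_iff]
    convert hev using 1
    ext i
    exact hb₀ i
  let b := b₀.toOrthonormalBasis hb₀o
  have hb : ∀ i, (b i : H) = e i := fun i => by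
    rw [show b i = b₀ i from congrFun (b₀.coe_toOrthonormalBasis hb₀o) i, hb₀]
  let P := V.orthogonalProjectionOnto
  let cmp : (H →L[ℂ] H) → (V →L[ℂ] V) := fun S => P.comp (S.comp V.subtypeL)
  have hcmp : ∀ S, ‖cmp S‖ ≤ ‖S‖ := fun S => by
    refine ContinuousLinearMap.opNorm_le_bound _ (norm_nonneg _) fun x => ?_
    exact (V.norm_orthogonalProjectionOnto_apply_le _).trans (S.le_opNorm x)
  have hVdim : Module.finrank ℂ V = m + m := by
    simpa using Module.finrank_eq_card_basis b₀
  have hrank : Module.finrank ℂ (LinearMap.range ((cmp R : V →L[ℂ] V) : V →ₗ[ℂ] V)) < m := by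
    refine Module.finrank_lt_of_rank_lt (lt_of_le_of_lt ?_ hR)
    have h1 := LinearMap.rank_comp_le_right ((R : H →ₗ[ℂ] H).comp V.subtype) (P : H →ₗ[ℂ] V)
    have h2 := LinearMap.rank_comp_le_left V.subtype (R : H →ₗ[ℂ] H)
    exact h1.trans h2
  have hdet : LinearMap.det ((cmp T : V →L[ℂ] V) : V →ₗ[ℂ] V)
      = ∏ i : Fin (m + m), μ ^ (i : ℕ) := by
    have hentry : ∀ i j, LinearMap.toMatrix b.toBasis b.toBasis
        ((cmp T : V →L[ℂ] V) : V →ₗ[ℂ] V) i j = ⟪e i, T (e j)⟫_ℂ := by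
      intro i j
      rw [LinearMap.toMatrix_apply, OrthonormalBasis.coe_toBasis,
        OrthonormalBasis.coe_toBasis_repr_apply, OrthonormalBasis.repr_apply_apply, ← hb i, ← hb j]
      exact V.inner_orthogonalProjectionOnto_eq_of_mem_left (b i) _
    rw [← LinearMap.det_toMatrix b.toBasis, Matrix.det_of_isLowerTriangular]
    · exact Finset.prod_congr rfl fun i _ => by rw [hentry, hdiag]
    · intro i j hij
      rw [hentry]
      exact hlow _ _ hij
  have key := norm_det_le_of_finrank_range_lt hVdim (cmp T) (cmp R) hrank
  have hsub : cmp T - cmp R = cmp (T - R) := by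
    ext x; simp [cmp]
  rw [hdet, hsub, Finset.prod_pow_eq_pow_sum, norm_pow, ← mul_pow] at key
  have hexp : ∑ i : Fin (m + m), (i : ℕ) ≤ 2 * m * m := by
    rw [Fin.sum_univ_eq_sum_range fun i => i]
    have := Finset.sum_range_id_mul_two (m + m)
    have h2 : (m + m) * (m + m - 1) ≤ (m + m) * (m + m) := Nat.mul_le_mul_left _ (Nat.sub_le _ _)
    nlinarith
  have h1 : (‖μ‖ ^ (2 * m)) ^ m ≤ (‖T - R‖ * ‖T‖) ^ m := by
    rw [← pow_mul]
    refine (pow_le_pow_of_le_one (norm_nonneg _) hμ hexp).trans (key.trans ?_)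
    gcongr
    · exact hcmp _
    · exact hcmp _
  exact le_of_pow_le_pow_left₀ (by omega) (by positivity) h1

/-! ### The basis of monomials -/

namespace BergmanSpace

variable {α : ℝ} {hα : -1 ≤ α}

/-- The element of the space given by the normalised monomial `zᵏ / √wₖ`. -/
noncomputable def monomial (α : ℝ) (hα : -1 ≤ α) (k : ℕ) : BergmanSpace α hα :=
  ⟨(ball (0 : ℂ) 1).indicator ((((√(bergmanWeight α k))⁻¹ : ℝ) : ℂ) • fun z => z ^ k),
    ((differentiableOn_id.pow k).const_smul _).congr Set.eqOn_indicator,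
    fun _ hz => Set.indicator_of_notMem hz _, by
      refine summable_of_ne_finset_zero (s := {k}) fun n hn => ?_
      rw [taylorCoeff_congr Set.eqOn_indicator, taylorCoeff_smul, taylorCoeff_pow,
        if_neg (by simpa using hn)]
      simp⟩

theorem monomial_apply (k : ℕ) {z : ℂ} (hz : z ∈ ball (0 : ℂ) 1) :
    monomial α hα k z = (((√(bergmanWeight α k))⁻¹ : ℝ) : ℂ) * z ^ k :=
  Set.indicator_of_mem hz _

theorem taylorCoeff_monomial (k n : ℕ) :
    taylorCoeff (monomial α hα k) n
      = (((√(bergmanWeight α k))⁻¹ : ℝ) : ℂ) * if n = k then 1 else 0 := by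
  refine (taylorCoeff_congr Set.eqOn_indicator n).trans ?_
  rw [taylorCoeff_smul, taylorCoeff_pow]

theorem toL2_monomial (k : ℕ) : toL2 (monomial α hα k) = lp.single 2 k (1 : ℂ) := by
  ext n
  have h : toL2 (monomial α hα k) n
      = ((√(bergmanWeight α n) : ℝ) : ℂ) * taylorCoeff (monomial α hα k) n := rfl
  rw [h, lp.single_apply, taylorCoeff_monomial, Pi.single_apply]
  split_ifs with hnk
  · subst hnk
    rw [mul_one, ← Complex.ofReal_mul,
      mul_inv_cancel₀ (Real.sqrt_pos.2 (bergmanWeight_pos hα n)).ne', Complex.ofReal_one]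
  · simp

theorem inner_monomial_left (k : ℕ) (g : BergmanSpace α hα) :
    inner ℂ (monomial α hα k) g = ((√(bergmanWeight α k) : ℝ) : ℂ) * taylorCoeff g k := by
  have h : inner ℂ (monomial α hα k) g = inner ℂ (toL2 (monomial α hα k)) (toL2 g) := rfl
  rw [h, toL2_monomial, lp.inner_single_left]
  simp
  rfl

theorem orthonormal_monomial : Orthonormal ℂ (monomial α hα) := by
  rw [orthonormal_iff_ite]
  intro j k
  have h : inner ℂ (monomial α hα j) (monomial α hα k)
      = inner ℂ (toL2 (monomial α hα j)) (toL2 (monomial α hα k)) := rfl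
  rw [h, toL2_monomial, toL2_monomial, lp.inner_single_left, lp.single_apply, Pi.single_apply]
  split_ifs <;> simp

end BergmanSpace

open BergmanSpace

/-- The lower bound when the symbol fixes the origin: the operator is then triangular in the basis
of monomials, with the powers of the derivative at the origin on the diagonal. -/
theorem norm_deriv_pow_le_of_fixed_zero {α : ℝ} {hα : -1 ≤ α} {ψ : ℂ → ℂ}
    (hψ : DifferentiableOn ℂ ψ (ball 0 1)) (hmap : Set.MapsTo ψ (ball 0 1) (ball 0 1))
    (h0 : ψ 0 = 0) {C : BergmanSpace α hα →L[ℂ] BergmanSpace α hα}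
    (hC : IsCompositionOperator ψ C) {m : ℕ} (hm : 1 ≤ m)
    (R : BergmanSpace α hα →L[ℂ] BergmanSpace α hα)
    (hR : (R : BergmanSpace α hα →ₗ[ℂ] BergmanSpace α hα).rank < m) :
    ‖deriv ψ 0‖ ^ (2 * m) ≤ ‖C - R‖ * ‖C‖ := by
  have hd : ∀ k, DifferentiableOn ℂ (fun z => dslope ψ 0 z ^ k) (ball 0 1) := fun k =>
    (differentiableOn_dslope_disc hψ).pow k
  have hfac : ∀ k, Set.EqOn (C (monomial α hα k))
      ((((√(bergmanWeight α k))⁻¹ : ℝ) : ℂ) • fun z => z ^ k * dslope ψ 0 z ^ k) (ball 0 1) := by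
    intro k z hz
    rw [hC _ z hz, monomial_apply k (hmap hz), eq_add_mul_dslope ψ z, h0, zero_add, mul_pow]
    rfl
  have hinner : ∀ j k, inner ℂ (monomial α hα j) (C (monomial α hα k))
      = ((√(bergmanWeight α j) : ℝ) : ℂ) * ((((√(bergmanWeight α k))⁻¹ : ℝ) : ℂ)
        * taylorCoeff (fun z => z ^ k * dslope ψ 0 z ^ k) j) := fun j k => by
    rw [inner_monomial_left, taylorCoeff_congr (hfac k), taylorCoeff_smul]
  refine norm_pow_le_norm_sub_mul_norm orthonormal_monomial C ?_ (fun j k hjk => ?_) (fun k => ?_)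
    hm R hR
  · exact Complex.norm_deriv_le_one_of_mapsTo_ball hψ
      (by rw [h0]; exact hmap.mono_right ball_subset_closedBall) one_pos
  · rw [hinner, taylorCoeff_pow_mul_of_lt (hd k) hjk, mul_zero, mul_zero]
  · have h := taylorCoeff_pow_mul_add (hd k) 0 k
    rw [zero_add] at h
    rw [hinner, h, taylorCoeff_zero_right, dslope_same, ← mul_assoc, ← Complex.ofReal_mul,
      mul_inv_cancel₀ (Real.sqrt_pos.2 (bergmanWeight_pos hα k)).ne', Complex.ofReal_one, one_mul]

/-! ### Moving a point of the disc to the origin -/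

/-- The symbol `φ` conjugated by automorphisms of the disc so that `a` and `φ a` become the
origin. -/
noncomputable def recentered (φ : ℂ → ℂ) (a z : ℂ) : ℂ := mobius (-φ a) (φ (mobius a z))

section Recentered

variable {φ : ℂ → ℂ} {a : ℂ}

theorem recentered_zero : recentered φ a 0 = 0 := by
  rw [recentered, mobius_zero, mobius_neg_self]

theorem differentiableOn_recentered (hφ : DifferentiableOn ℂ φ (ball 0 1))
    (hmap : Set.MapsTo φ (ball 0 1) (ball 0 1)) (ha : ‖a‖ < 1) :
    DifferentiableOn ℂ (recentered φ a) (ball 0 1) := by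
  have hb : ‖-φ a‖ < 1 := by
    rw [norm_neg]; exact mem_ball_zero_iff.1 (hmap (mem_ball_zero_iff.2 ha))
  exact (differentiableOn_mobius hb).comp (hφ.comp (differentiableOn_mobius ha) (mapsTo_mobius ha))
    (hmap.comp (mapsTo_mobius ha))

theorem mapsTo_recentered (hmap : Set.MapsTo φ (ball 0 1) (ball 0 1)) (ha : ‖a‖ < 1) :
    Set.MapsTo (recentered φ a) (ball 0 1) (ball 0 1) := by
  have hb : ‖-φ a‖ < 1 := by
    rw [norm_neg]; exact mem_ball_zero_iff.1 (hmap (mem_ball_zero_iff.2 ha))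
  exact (mapsTo_mobius hb).comp (hmap.comp (mapsTo_mobius ha))

theorem norm_deriv_recentered (hφ : DifferentiableOn ℂ φ (ball 0 1))
    (hmap : Set.MapsTo φ (ball 0 1) (ball 0 1)) (ha : ‖a‖ < 1) :
    ‖deriv (recentered φ a) 0‖ = pseudoHypDeriv φ a := by
  have hb : ‖φ a‖ < 1 := mem_ball_zero_iff.1 (hmap (mem_ball_zero_iff.2 ha))
  have hb' : ‖-φ a‖ < 1 := by rwa [norm_neg]
  have h1 := hasDerivAt_mobius (z := 0) ha (by simp)
  have h2 : HasDerivAt φ (deriv φ a) (mobius a 0) := by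
    rw [mobius_zero]
    exact (hφ.differentiableAt (isOpen_ball.mem_nhds (mem_ball_zero_iff.2 ha))).hasDerivAt
  have h3 : HasDerivAt (mobius (-φ a))
      (((1 - ‖-φ a‖ ^ 2 : ℝ) : ℂ) / (1 + (starRingEnd ℂ) (-φ a) * φ a) ^ 2)
      (φ (mobius a 0)) := by
    rw [mobius_zero]
    exact hasDerivAt_mobius hb' hb
  have h : HasDerivAt (recentered φ a) _ 0 := h3.comp (0 : ℂ) (h2.comp (0 : ℂ) h1)
  have ha2 : 0 < 1 - ‖a‖ ^ 2 := by nlinarith [norm_nonneg a]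
  have hb2 : 0 < 1 - ‖φ a‖ ^ 2 := by nlinarith [norm_nonneg (φ a)]
  have e : 1 + (starRingEnd ℂ) (-φ a) * φ a = ((1 - ‖φ a‖ ^ 2 : ℝ) : ℂ) := by
    rw [map_neg, neg_mul, mul_comm, Complex.mul_conj, Complex.normSq_eq_norm_sq]
    push_cast
    ring
  rw [h.deriv, e, norm_mul, norm_mul, norm_div, norm_div, norm_pow, Complex.norm_real, Complex.norm_real,
    Complex.norm_real, norm_neg, Real.norm_of_nonneg ha2.le, Real.norm_of_nonneg hb2.le,
    pseudoHypDeriv]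
  simp only [mul_zero, add_zero, norm_one, one_pow, div_one]
  field_simp

theorem pseudoHypDeriv_le_one (hφ : DifferentiableOn ℂ φ (ball 0 1))
    (hmap : Set.MapsTo φ (ball 0 1) (ball 0 1)) (ha : ‖a‖ < 1) : pseudoHypDeriv φ a ≤ 1 := by
  rw [← norm_deriv_recentered hφ hmap ha]
  refine Complex.norm_deriv_le_one_of_mapsTo_ball (differentiableOn_recentered hφ hmap ha) ?_
    one_pos
  rw [recentered_zero]
  exact (mapsTo_recentered hmap ha).mono_right ball_subset_closedBall

/-- The operator of the recentered symbol is `A C B` with `A`, `B` bounded, so that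
`‖A C B - A R B‖ ≤ ‖A‖ ‖C - R‖ ‖B‖` carries its lower bound over to `C`. -/
theorem exists_le_approxNumber {α : ℝ} {hα : -1 ≤ α} (hφ : DifferentiableOn ℂ φ (ball 0 1))
    (hmap : Set.MapsTo φ (ball 0 1) (ball 0 1)) (ha : ‖a‖ < 1)
    {C : BergmanSpace α hα →L[ℂ] BergmanSpace α hα} (hC : IsCompositionOperator φ C) :
    ∃ c : ℝ, 0 < c ∧ ∀ n : ℕ, 1 ≤ n → c * pseudoHypDeriv φ a ^ (2 * n) ≤ approxNumber C n := by
  have hb : ‖-φ a‖ < 1 := by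
    rw [norm_neg]; exact mem_ball_zero_iff.1 (hmap (mem_ball_zero_iff.2 ha))
  obtain ⟨A, hA⟩ := exists_compositionOperator hα (differentiableOn_mobius ha) (mapsTo_mobius ha)
  obtain ⟨B, hB⟩ := exists_compositionOperator hα (differentiableOn_mobius hb) (mapsTo_mobius hb)
  set S := A.comp (C.comp B) with hS
  have hSc : IsCompositionOperator (recentered φ a) S := by
    intro f z hz
    change A (C (B f)) z = _
    rw [hA _ z hz, hC _ _ (mapsTo_mobius ha hz), hB _ _ (hmap (mapsTo_mobius ha hz))]
    rfl
  have hpos : 0 < ‖A‖ * ‖B‖ * ‖S‖ + 1 := by positivity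
  refine ⟨(‖A‖ * ‖B‖ * ‖S‖ + 1)⁻¹, by positivity, fun n hn => ?_⟩
  refine le_csInf ⟨_, 0, ?_, rfl⟩ ?_
  · rw [ContinuousLinearMap.toLinearMap_zero, LinearMap.rank_zero]
    exact_mod_cast hn
  · rintro x ⟨R, hR, rfl⟩
    set R' := A.comp (R.comp B) with hR'
    have hrank : (R' : BergmanSpace α hα →ₗ[ℂ] BergmanSpace α hα).rank < n := by
      refine lt_of_le_of_lt ?_ hR
      have h1 := LinearMap.rank_comp_le_right
        ((R : BergmanSpace α hα →ₗ[ℂ] BergmanSpace α hα).comp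
          (B : BergmanSpace α hα →ₗ[ℂ] BergmanSpace α hα))
        (A : BergmanSpace α hα →ₗ[ℂ] BergmanSpace α hα)
      have h2 := LinearMap.rank_comp_le_left (B : BergmanSpace α hα →ₗ[ℂ] BergmanSpace α hα)
        (R : BergmanSpace α hα →ₗ[ℂ] BergmanSpace α hα)
      exact h1.trans h2
    have key := norm_deriv_pow_le_of_fixed_zero (differentiableOn_recentered hφ hmap ha)
      (mapsTo_recentered hmap ha) recentered_zero hSc hn R' hrank
    rw [norm_deriv_recentered hφ hmap ha] at key
    have hsub : S - R' = A.comp ((C - R).comp B) := by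
      rw [hS, hR', ContinuousLinearMap.sub_comp, ContinuousLinearMap.comp_sub]
    have hnorm : ‖S - R'‖ ≤ ‖A‖ * (‖C - R‖ * ‖B‖) := by
      rw [hsub]
      exact (ContinuousLinearMap.opNorm_comp_le _ _).trans
        (mul_le_mul_of_nonneg_left (ContinuousLinearMap.opNorm_comp_le _ _) (norm_nonneg _))
    rw [inv_mul_le_iff₀ hpos]
    have := mul_le_mul_of_nonneg_right hnorm (norm_nonneg S)
    nlinarith [norm_nonneg (C - R)]

end Recentered

theorem bddAbove_pseudoHypDeriv {φ : ℂ → ℂ} (hφ : IsSchur φ) :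
    BddAbove (pseudoHypDeriv φ '' ball 0 1) := by
  refine ⟨1, ?_⟩
  rintro _ ⟨a, ha, rfl⟩
  exact pseudoHypDeriv_le_one hφ.differentiableOn hφ.mapsTo (mem_ball_zero_iff.1 ha)

theorem pseudoHypSup_pos {φ : ℂ → ℂ} (hφ : IsSchur φ) : 0 < pseudoHypSup φ := by
  have hex : ∃ z ∈ ball (0 : ℂ) 1, deriv φ z ≠ 0 := by
    by_contra! h
    refine hφ.nonconstant ⟨φ 0, fun z hz => ?_⟩
    exact isOpen_ball.is_const_of_deriv_eq_zero (convex_ball (0 : ℂ) 1).isPreconnected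
      hφ.differentiableOn h hz (mem_ball_self one_pos)
  obtain ⟨z, hz, hne⟩ := hex
  refine lt_of_lt_of_le ?_ (le_csSup (bddAbove_pseudoHypDeriv hφ) ⟨z, hz, rfl⟩)
  have h1 := mem_ball_zero_iff.1 hz
  have h2 := mem_ball_zero_iff.1 (hφ.mapsTo hz)
  have h3 : 0 < 1 - ‖z‖ ^ 2 := by nlinarith [norm_nonneg z]
  have h4 : 0 < 1 - ‖φ z‖ ^ 2 := by nlinarith [norm_nonneg (φ z)]
  have h5 := norm_pos_iff.2 hne
  unfold pseudoHypDeriv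
  positivity

/-! ### Approximation numbers and the geometric lower bounds -/

theorem approxNumber_nonneg {E F : Type*} [NormedAddCommGroup E] [NormedSpace ℂ E]
    [NormedAddCommGroup F] [NormedSpace ℂ F] (T : E →L[ℂ] F) (n : ℕ) : 0 ≤ approxNumber T n :=
  Real.sInf_nonneg fun _ ⟨_, _, h⟩ => h ▸ norm_nonneg _

theorem approxNumber_le_norm {E F : Type*} [NormedAddCommGroup E] [NormedSpace ℂ E]
    [NormedAddCommGroup F] [NormedSpace ℂ F] (T : E →L[ℂ] F) {n : ℕ} (hn : 1 ≤ n) :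
    approxNumber T n ≤ ‖T‖ := by
  refine csInf_le ⟨0, fun _ ⟨_, _, h⟩ => h ▸ norm_nonneg _⟩ ⟨0, ?_, by rw [sub_zero]⟩
  rw [ContinuousLinearMap.toLinearMap_zero, LinearMap.rank_zero]
  exact_mod_cast hn

/-- The bound `‖T‖` keeps the roots bounded above, without which the lower limit in `ℝ` would be a
junk value. -/
theorem le_betaLower_of_geometric {E F : Type*} [NormedAddCommGroup E] [NormedSpace ℂ E]
    [NormedAddCommGroup F] [NormedSpace ℂ F] {T : E →L[ℂ] F} {c r : ℝ} (hc : 0 < c) (hr : 0 ≤ r)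
    (h : ∀ n : ℕ, 1 ≤ n → c * r ^ n ≤ approxNumber T n) : r ≤ betaLower T := by
  have hlim : Tendsto (fun n : ℕ => c ^ (1 / (n : ℝ)) * r) atTop (nhds r) := by
    have := ((Real.continuousAt_const_rpow hc.ne').tendsto.comp
      tendsto_one_div_atTop_nhds_zero_nat).mul_const r
    simpa using this
  have hbdd : IsBoundedUnder (· ≤ ·) atTop fun n : ℕ => approxNumber T n ^ (1 / (n : ℝ)) := by
    refine ⟨max 1 ‖T‖, ?_⟩
    rw [eventually_map]
    filter_upwards [eventually_ge_atTop 1] with n hn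
    have hn' : (1 : ℝ) ≤ n := by exact_mod_cast hn
    calc approxNumber T n ^ (1 / (n : ℝ)) ≤ max 1 ‖T‖ ^ (1 / (n : ℝ)) := by
          refine Real.rpow_le_rpow (approxNumber_nonneg T n) ?_ (by positivity)
          exact (approxNumber_le_norm T hn).trans (le_max_right _ _)
      _ ≤ max 1 ‖T‖ ^ (1 : ℝ) := Real.rpow_le_rpow_of_exponent_le (le_max_left _ _)
          ((div_le_one (by positivity)).2 hn')
      _ = _ := Real.rpow_one _
  rw [← hlim.liminf_eq]
  refine liminf_le_liminf ?_ hlim.isBoundedUnder_ge hbdd.isCoboundedUnder_ge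
  filter_upwards [eventually_ge_atTop 1] with n hn
  have hn0 : (n : ℝ) ≠ 0 := by exact_mod_cast (by omega : n ≠ 0)
  calc c ^ (1 / (n : ℝ)) * r = (c * r ^ n) ^ (1 / (n : ℝ)) := by
        rw [Real.mul_rpow hc.le (pow_nonneg hr n), ← Real.rpow_natCast, ← Real.rpow_mul hr,
          mul_one_div_cancel hn0, Real.rpow_one]
    _ ≤ _ := Real.rpow_le_rpow (by positivity) (h n hn) (by positivity)

theorem mainTheorem2 (α : ℝ) (hα : -1 ≤ α) (φ : ℂ → ℂ) (hφ : IsSchur φ) :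
    ∃ C : BergmanSpace α hα →L[ℂ] BergmanSpace α hα,
      IsCompositionOperator φ C ∧
      (∃ c r : ℝ, 0 < c ∧ 0 < r ∧ r < 1 ∧ ∀ n : ℕ, 1 ≤ n → c * r ^ n ≤ approxNumber C n) ∧
      pseudoHypSup φ ^ 2 ≤ betaLower C ∧
      ∀ κ : ℝ, 0 ≤ κ → κ < pseudoHypSup φ →
        ∃ c : ℝ, 0 < c ∧ ∀ n : ℕ, 1 ≤ n → c * κ ^ (2 * n) ≤ approxNumber C n := by
  obtain ⟨C, hC⟩ := exists_compositionOperator hα hφ.differentiableOn hφ.mapsTo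
  have hne : (pseudoHypDeriv φ '' ball 0 1).Nonempty := ⟨_, 0, mem_ball_self one_pos, rfl⟩
  have hgeom : ∀ κ : ℝ, 0 ≤ κ → κ < pseudoHypSup φ →
      ∃ c : ℝ, 0 < c ∧ ∀ n : ℕ, 1 ≤ n → c * κ ^ (2 * n) ≤ approxNumber C n := by
    intro κ hκ0 hκ
    obtain ⟨_, ⟨a, ha, rfl⟩, hκa⟩ := exists_lt_of_lt_csSup hne hκ
    obtain ⟨c, hc, hb⟩ := exists_le_approxNumber hφ.differentiableOn hφ.mapsTo
      (mem_ball_zero_iff.1 ha) hC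
    refine ⟨c, hc, fun n hn => le_trans ?_ (hb n hn)⟩
    gcongr
  have hpos := pseudoHypSup_pos hφ
  have hle : pseudoHypSup φ ≤ 1 := csSup_le hne fun _ ⟨a, ha, h⟩ =>
    h ▸ pseudoHypDeriv_le_one hφ.differentiableOn hφ.mapsTo (mem_ball_zero_iff.1 ha)
  refine ⟨C, hC, ?_, ?_, hgeom⟩
  · obtain ⟨c, hc, hb⟩ := hgeom (pseudoHypSup φ / 2) (by positivity) (by linarith)
    refine ⟨c, (pseudoHypSup φ / 2) ^ 2, hc, by positivity, by nlinarith, fun n hn => ?_⟩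
    rw [← pow_mul]
    exact hb n hn
  · have hκ : ∀ κ : ℝ, 0 ≤ κ → κ < pseudoHypSup φ → κ ^ 2 ≤ betaLower C := by
      intro κ hκ0 hκ
      obtain ⟨c, hc, hb⟩ := hgeom κ hκ0 hκ
      exact le_betaLower_of_geometric hc (sq_nonneg κ) fun n hn => by
        rw [← pow_mul]
        exact hb n hn
    refine le_of_tendsto (f := fun κ : ℝ => κ ^ 2) (x := nhdsWithin (pseudoHypSup φ)
      (Set.Iio (pseudoHypSup φ)))
      ((continuous_pow 2).continuousAt.tendsto.mono_left nhdsWithin_le_nhds) ?_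
    filter_upwards [Ioo_mem_nhdsLT hpos] with κ hκ1
    exact hκ κ hκ1.1.le hκ1.2
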